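/- Let $R$ be an associative ring with identity and let $G$ be a finite group with identity element $e$ such that $|G|$ (that is, $|G|\cdot 1_R$) is a unit in $R$. Let $\alpha=(\{D_g\}_{g\in G},\{\alpha_g\}_{g\in G},\{w_{g,h}\}_{(g,h)\in G\times G})$ be a unital twisted partial action of $G$ on $R$: for each $g\in G$, $D_g$ is a two-sided ideal of $R$ generated by a central idempotent $1_g$ and $\alpha_g:D_{g^{-1}}\to D_g$ is an isomorphism of rings, and for all $g,h\in G$, $w_{g,h}$ is an invertible element of the ring $D_gD_{gh}$ (whose identity is $1_g1_{gh}$), such that for all $g,h,t\in G$: 1. $D_e=R$ and $\alpha_e=\mathrm{id}_R$; 2. $\alpha_g(D_{g^{-1}}D_h)=D_gD_{gh}$; 3. $\alpha_g(\alpha_h(a))=w_{g,h}\,\alpha_{gh}(a)\,w_{g,h}^{-1}$ for all $a\in D_{h^{-1}}D_{h^{-1}g^{-1}}$; 4. $w_{g,e}=w_{e,g}=1_g$; 5. $\alpha_g(a\,w_{h,t})\,w_{g,ht}=\alpha_g(a)\,w_{g,h}\,w_{gh,t}$ for all $a\in D_{g^{-1}}D_hD_{ht}$. Let $R*_{\alpha,w}G=\bigoplus_{g\in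 G}D_g\delta_g$ be the partial crossed product, i.e. the associative ring with identity $1_R\delta_e$ and multiplication determined by $(a\,\delta_g)(b\,\delta_h)=\alpha_g(\alpha_g^{-1}(a)\,b)\,w_{g,h}\,\delta_{gh}$ for $a\in D_g$, $b\in D_h$. For a ring $S$, a right $S$-module $M$ is flat if $M\otimes_S-$ is an exact functor; its flat dimension is the least $n\ge 0$ for which there is an exact sequence $0\to F_n\to\cdots\to F_0\to M\to 0$ with all $F_i$ flat ($\infty$ if there is none); and $\mathrm{w.dim}(S)\in\{0,1,2,\dots,\infty\}$ is the supremum of the flat dimensions of all right $S$-modules. Then $$\mathrm{w.dim}(R*_{\alpha,w}G)=\mathrm{w.dim}(R).$$ -/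

import Mathlib

section TwistedPartialActions

/-- The product `I J` of two two-sided ideals: the two-sided ideal generated by the products
`a * b` with `a ∈ I` and `b ∈ J`. -/
def TwoSidedIdeal.prod {R : Type*} [Ring R] (I J : TwoSidedIdeal R) : TwoSidedIdeal R :=
  TwoSidedIdeal.span {x | ∃ a ∈ I, ∃ b ∈ J, x = a * b}

/-- A unital twisted partial action of a group `G` on an associative unital ring `R`: two-sided
ideals `D g` generated by central idempotents `idem g` (written `1_g`), ring isomorphisms
`act g : D g⁻¹ ≃+* D g` (written `α_g`), and invertible elements `w g h` of the ring
`D g · D (g * h)` (whose identity is `1_g * 1_{gh}`), with inverse `winv g h` there.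
In `act_act` the memberships `a ∈ D h⁻¹`, `α_h a ∈ D g⁻¹` and `a ∈ D (g * h)⁻¹`, which are needed
to form the two sides, are consequences of `a ∈ D h⁻¹ · D (h⁻¹ * g⁻¹)` and `act_image`. -/
structure UnitalTwistedPartialAction (G R : Type*) [Group G] [Ring R] where
  D : G → TwoSidedIdeal R
  idem : G → R
  idem_isIdempotentElem : ∀ g, IsIdempotentElem (idem g)
  idem_mem_center : ∀ g, idem g ∈ Subring.center R
  D_eq : ∀ g, D g = TwoSidedIdeal.span {idem g}
  act : ∀ g, D g⁻¹ ≃+* D g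
  w : G → G → R
  winv : G → G → R
  w_mem : ∀ g h, w g h ∈ (D g).prod (D (g * h))
  winv_mem : ∀ g h, winv g h ∈ (D g).prod (D (g * h))
  w_mul_winv : ∀ g h, w g h * winv g h = idem g * idem (g * h)
  winv_mul_w : ∀ g h, winv g h * w g h = idem g * idem (g * h)
  D_one : D 1 = ⊤
  act_one : ∀ a : D 1⁻¹, (act 1 a : R) = a
  act_image : ∀ g h, (fun x : D g⁻¹ => (act g x : R)) '' {x | (x : R) ∈ (D g⁻¹).prod (D h)} =
    ((D g).prod (D (g * h)) : Set R)
  act_act : ∀ g h (a : R), a ∈ (D h⁻¹).prod (D (h⁻¹ * g⁻¹)) →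
    ∀ (h₁ : a ∈ D h⁻¹) (h₂ : (act h ⟨a, h₁⟩ : R) ∈ D g⁻¹) (h₃ : a ∈ D (g * h)⁻¹),
      (act g ⟨act h ⟨a, h₁⟩, h₂⟩ : R) = w g h * act (g * h) ⟨a, h₃⟩ * winv g h
  w_one_right : ∀ g, w g 1 = idem g
  w_one_left : ∀ g, w 1 g = idem g
  cocycle : ∀ g h t (a : R) (ha : a ∈ D g⁻¹),
    a ∈ ((D g⁻¹).prod (D h)).prod (D (h * t)) →
      (act g ⟨a * w h t, (D g⁻¹).mul_mem_right _ _ ha⟩ : R) * w g (h * t) =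
        act g ⟨a, ha⟩ * w g h * w (g * h) t

namespace UnitalTwistedPartialAction

variable {G R : Type*} [Group G] [Ring R] (α : UnitalTwistedPartialAction G R)

theorem idem_comm (g : G) (x : R) : α.idem g * x = x * α.idem g :=
  (Subring.mem_center_iff.mp (α.idem_mem_center g) x).symm

theorem idem_idem (g : G) : α.idem g * α.idem g = α.idem g := α.idem_isIdempotentElem g

theorem mem_D {g : G} {x : R} : x ∈ α.D g ↔ α.idem g * x = x := by
  rw [α.D_eq]
  constructor
  · intro hx
    have h : TwoSidedIdeal.span {α.idem g} ≤ TwoSidedIdeal.mk' {x | α.idem g * x = x}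
        (by simp) (fun {x y} hx hy => by
          simp only [Set.mem_ofPred_eq] at *; rw [mul_add, hx, hy])
        (fun {x} hx => by simp only [Set.mem_ofPred_eq] at *; rw [mul_neg, hx])
        (fun {x y} hy => by
          simp only [Set.mem_ofPred_eq] at *
          rw [← mul_assoc, α.idem_comm, mul_assoc, hy])
        (fun {x y} hx => by simp only [Set.mem_ofPred_eq] at *; rw [← mul_assoc, hx]) := by
      rw [TwoSidedIdeal.span_le]
      intro y hy
      rw [Set.mem_singleton_iff] at hy
      subst hy
      exact (TwoSidedIdeal.mem_mk' _ _ _ _ _ _ _).2 (α.idem_idem g)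
    have h' := h hx
    rw [TwoSidedIdeal.mem_mk'] at h'
    exact h'
  · intro hx
    rw [← hx]
    exact TwoSidedIdeal.mul_mem_right _ _ _ (TwoSidedIdeal.subset_span rfl)

theorem idem_mem (g : G) : α.idem g ∈ α.D g := α.mem_D.2 (α.idem_idem g)

theorem idem_mul_mem (g : G) (x : R) : α.idem g * x ∈ α.D g :=
  (α.D g).mul_mem_right _ _ (α.idem_mem g)

theorem idem_mul {g : G} {x : R} (hx : x ∈ α.D g) : α.idem g * x = x := α.mem_D.1 hx

theorem mul_idem {g : G} {x : R} (hx : x ∈ α.D g) : x * α.idem g = x := by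
  rw [← α.idem_comm, α.idem_mul hx]

theorem prod_le_left (I J : TwoSidedIdeal R) : I.prod J ≤ I := by
  refine TwoSidedIdeal.span_le.2 ?_
  rintro x ⟨a, ha, b, -, rfl⟩
  exact I.mul_mem_right _ _ ha

theorem prod_le_right (I J : TwoSidedIdeal R) : I.prod J ≤ J := by
  refine TwoSidedIdeal.span_le.2 ?_
  rintro x ⟨a, -, b, hb, rfl⟩
  exact J.mul_mem_left _ _ hb

theorem mem_prod_D {I : TwoSidedIdeal R} {h : G} {x : R} :
    x ∈ I.prod (α.D h) ↔ x ∈ I ∧ x ∈ α.D h := by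
  refine ⟨fun hx => ⟨prod_le_left _ _ hx, prod_le_right _ _ hx⟩, fun ⟨h1, h2⟩ => ?_⟩
  exact TwoSidedIdeal.subset_span ⟨x, h1, _, α.idem_mem h, (α.mul_idem h2).symm⟩

theorem idem_one : α.idem 1 = 1 := by
  have h : (1 : R) ∈ α.D 1 := by rw [α.D_one]; trivial
  simpa using α.idem_mul h

/-- The extension of `α_g` to all of `R` by `x ↦ α_g (1_{g⁻¹} x)`. -/
def actExt (g : G) : R →+ R where
  toFun x := α.act g ⟨α.idem g⁻¹ * x, α.idem_mul_mem _ _⟩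
  map_zero' := by
    have : (⟨α.idem g⁻¹ * 0, α.idem_mul_mem _ _⟩ : α.D g⁻¹) = 0 := Subtype.ext (mul_zero _)
    rw [this, map_zero]; rfl
  map_add' x y := by
    have : (⟨α.idem g⁻¹ * (x + y), α.idem_mul_mem _ _⟩ : α.D g⁻¹) =
      ⟨α.idem g⁻¹ * x, α.idem_mul_mem _ _⟩ + ⟨α.idem g⁻¹ * y, α.idem_mul_mem _ _⟩ :=
      Subtype.ext (mul_add _ _ _)
    rw [this, map_add]; rfl

theorem actExt_apply {g : G} {x : R} (hx : x ∈ α.D g⁻¹) : α.actExt g x = α.act g ⟨x, hx⟩ := by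
  change (α.act g _ : R) = _
  congr 2
  exact Subtype.ext (α.idem_mul hx)

theorem actExt_mem (g : G) (x : R) : α.actExt g x ∈ α.D g := (α.act g _).2

theorem actExt_mul (g : G) (x y : R) : α.actExt g (x * y) = α.actExt g x * α.actExt g y := by
  have : (⟨α.idem g⁻¹ * (x * y), α.idem_mul_mem _ _⟩ : α.D g⁻¹) =
      ⟨α.idem g⁻¹ * x, α.idem_mul_mem _ _⟩ * ⟨α.idem g⁻¹ * y, α.idem_mul_mem _ _⟩ := by
    refine Subtype.ext ?_
    change α.idem g⁻¹ * (x * y) = α.idem g⁻¹ * x * (α.idem g⁻¹ * y)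
    rw [α.idem_comm g⁻¹ x, mul_assoc, ← mul_assoc (α.idem g⁻¹) (α.idem g⁻¹), α.idem_idem,
      ← mul_assoc, ← mul_assoc, α.idem_comm]
  change (α.act g _ : R) = (α.act g _ : R) * α.act g _
  rw [this, map_mul]; rfl

theorem actExt_idem_mul (g : G) (x : R) : α.actExt g (α.idem g⁻¹ * x) = α.actExt g x := by
  change (α.act g _ : R) = α.act g _
  congr 2
  refine Subtype.ext ?_
  change α.idem g⁻¹ * (α.idem g⁻¹ * x) = α.idem g⁻¹ * x
  rw [← mul_assoc, α.idem_idem]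

theorem actExt_mem_of_mem {g h : G} {x : R} (hx : x ∈ α.D h) : α.actExt g x ∈ α.D (g * h) := by
  have h1 : (α.idem g⁻¹ * x) ∈ (α.D g⁻¹).prod (α.D h) :=
    α.mem_prod_D.2 ⟨α.idem_mul_mem _ _, (α.D h).mul_mem_left _ _ hx⟩
  have h2 : α.actExt g x ∈ ((α.D g).prod (α.D (g * h)) : Set R) := by
    rw [← α.act_image]
    exact ⟨⟨_, α.idem_mul_mem _ _⟩, h1, rfl⟩
  exact prod_le_right _ _ h2

theorem actExt_idem (g h : G) : α.actExt g (α.idem h) = α.idem g * α.idem (g * h) := by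
  have hy : α.idem g * α.idem (g * h) ∈ ((α.D g).prod (α.D (g * h)) : Set R) :=
    α.mem_prod_D.2 ⟨α.idem_mul_mem _ _, (α.D _).mul_mem_left _ _ (α.idem_mem _)⟩
  rw [← α.act_image] at hy
  obtain ⟨x, hx, hxy⟩ := hy
  have hxe : α.actExt g x = α.idem g * α.idem (g * h) := by
    rw [← hxy]; exact α.actExt_apply x.2
  have h1 : (x : R) * α.idem h = x := α.mul_idem (prod_le_right _ _ hx)
  have h2 : α.actExt g x * α.actExt g (α.idem h) = α.actExt g x := by rw [← α.actExt_mul, h1]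
  rw [hxe, mul_assoc, α.idem_mul (α.actExt_mem_of_mem (α.idem_mem h)),
    α.idem_mul (α.actExt_mem g _)] at h2
  exact h2

theorem actExt_one (x : R) : α.actExt 1 x = x := by
  have hx : x ∈ α.D 1⁻¹ := by rw [inv_one, α.D_one]; trivial
  rw [α.actExt_apply hx, α.act_one]

theorem w_mem_left (g h : G) : α.w g h ∈ α.D g := prod_le_left _ _ (α.w_mem g h)

theorem w_mem_right (g h : G) : α.w g h ∈ α.D (g * h) := prod_le_right _ _ (α.w_mem g h)

theorem actExt_ext (g h : G) (x : R) :
    α.actExt g (α.actExt h x) * α.w g h = α.w g h * α.actExt (g * h) x := by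
  set y : R := α.idem h⁻¹ * (α.idem (h⁻¹ * g⁻¹) * x) with hy
  have hy1 : y ∈ α.D h⁻¹ := α.idem_mul_mem _ _
  have hy2 : y ∈ α.D (h⁻¹ * g⁻¹) := (α.D _).mul_mem_left _ _ (α.idem_mul_mem _ _)
  have hy3 : y ∈ α.D (g * h)⁻¹ := by rw [mul_inv_rev]; exact hy2
  have hh : α.actExt h y = α.idem h * α.idem g⁻¹ * α.actExt h x := by
    rw [hy, α.actExt_idem_mul, α.actExt_mul, α.actExt_idem, mul_inv_cancel_left]
  have hg : α.actExt g (α.actExt h y) = α.idem g * α.idem (g * h) * α.actExt g (α.actExt h x) := by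
    rw [hh, mul_assoc, α.idem_comm h, mul_assoc, ← α.idem_comm h, α.actExt_idem_mul,
      α.actExt_mul, α.actExt_idem]
  have hgh : α.actExt (g * h) y = α.idem (g * h) * α.idem g * α.actExt (g * h) x := by
    rw [hy, α.actExt_mul, α.actExt_idem, mul_inv_cancel_right, ← mul_inv_rev, α.actExt_idem_mul]
  have hm : (α.act h ⟨y, hy1⟩ : R) ∈ α.D g⁻¹ := by
    have := α.actExt_mem_of_mem (g := h) hy2
    rwa [mul_inv_cancel_left, α.actExt_apply hy1] at this
  have key := α.act_act g h y (α.mem_prod_D.2 ⟨hy1, hy2⟩) hy1 hm hy3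
  rw [← α.actExt_apply hy3, ← α.actExt_apply hm, ← α.actExt_apply hy1, hg, hgh] at key
  have key2 := congrArg (· * α.w g h) key
  have e1 : α.idem g * α.idem (g * h) * α.actExt g (α.actExt h x) * α.w g h =
      α.actExt g (α.actExt h x) * α.w g h := by
    rw [mul_assoc (α.idem g), α.idem_comm (g * h), ← mul_assoc, α.idem_mul (α.actExt_mem g _),
      mul_assoc, α.idem_mul (α.w_mem_right g h)]
  have e2 : α.w g h * (α.idem (g * h) * α.idem g * α.actExt (g * h) x) * α.winv g h * α.w g h =
      α.w g h * α.actExt (g * h) x := by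
    have e3 : α.w g h * (α.idem (g * h) * α.idem g * α.actExt (g * h) x) =
        α.w g h * α.actExt (g * h) x := by
      rw [← mul_assoc, ← mul_assoc, α.mul_idem (α.w_mem_right g h),
        α.mul_idem (α.w_mem_left g h)]
    rw [e3, mul_assoc _ (α.winv g h), α.winv_mul_w, ← mul_assoc,
      α.mul_idem ((α.D g).mul_mem_right _ _ (α.w_mem_left g h)),
      α.mul_idem ((α.D (g * h)).mul_mem_left _ _ (α.actExt_mem _ _))]
  rw [e1, e2] at key2
  exact key2

theorem actExt_w (g h t : G) :
    α.actExt g (α.w h t) * α.w g (h * t) = α.w g h * α.w (g * h) t := by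
  set a : R := α.idem g⁻¹ * α.idem h * α.idem (h * t) with ha
  have h0 : α.idem g⁻¹ * α.idem h ∈ (α.D g⁻¹).prod (α.D h) :=
    α.mem_prod_D.2 ⟨α.idem_mul_mem _ _, (α.D _).mul_mem_left _ _ (α.idem_mem _)⟩
  have h1 : a ∈ ((α.D g⁻¹).prod (α.D h)).prod (α.D (h * t)) :=
    α.mem_prod_D.2 ⟨((α.D g⁻¹).prod (α.D h)).mul_mem_right _ _ h0,
      (α.D _).mul_mem_left _ _ (α.idem_mem _)⟩
  have h2 : a ∈ α.D g⁻¹ := prod_le_left _ _ (prod_le_left _ _ h1)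
  have key := α.cocycle g h t a h2 h1
  rw [← α.actExt_apply, ← α.actExt_apply, ha, mul_assoc _ _ (α.w h t), α.idem_mul (α.w_mem_right h t),
    mul_assoc, α.idem_mul (α.w_mem_left h t), α.actExt_idem_mul, mul_assoc (α.idem g⁻¹),
    α.actExt_idem_mul, α.actExt_mul, α.actExt_idem, α.actExt_idem] at key
  rw [key]
  have e1 := α.idem_mul ((α.D (g * h * t)).mul_mem_left (α.w g h) _ (α.w_mem_right (g * h) t))
  have e2 := α.idem_mul ((α.D g).mul_mem_right _ (α.w (g * h) t) (α.w_mem_left g h))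
  have e3 := α.idem_mul ((α.D (g * h)).mul_mem_right _ (α.w (g * h) t) (α.w_mem_right g h))
  rw [← mul_assoc g h t]
  simp only [mul_assoc] at e1 e2 e3 ⊢
  rw [e1, e2, e3, e2]

/-- The product of homogeneous components:
`(a δ_g) (b δ_h) = α_g (α_g⁻¹ (a) b) w_{g,h} δ_{gh}`. -/
def mulCoeff (g h : G) (a : α.D g) (b : α.D h) : α.D (g * h) :=
  ⟨α.act g ⟨(α.act g).symm a * b, (α.D g⁻¹).mul_mem_right _ _ ((α.act g).symm a).2⟩ * α.w g h,
    (α.D (g * h)).mul_mem_left _ _ (α.w_mem_right g h)⟩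

theorem coe_mulCoeff (g h : G) (a : α.D g) (b : α.D h) :
    (α.mulCoeff g h a b : R) = a * α.actExt g b * α.w g h := by
  change (α.act g _ : R) * α.w g h = _
  rw [← α.actExt_apply, α.actExt_mul, α.actExt_apply ((α.act g).symm a).2]
  simp

/-- The partial crossed product `R *_{α,w} G`, the direct sum of the `D g δ_g`. -/
def CrossedProduct (α : UnitalTwistedPartialAction G R) : Type _ :=
  DirectSum G fun g => α.D g

namespace CrossedProduct

noncomputable instance : AddCommGroup α.CrossedProduct :=
  inferInstanceAs (AddCommGroup (DirectSum G fun g => α.D g))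

open Classical in
/-- The element `a δ_g`. -/
noncomputable def δ (g : G) : α.D g →+ α.CrossedProduct :=
  DirectSum.of (fun g => α.D g) g

@[elab_as_elim]
theorem induction {p : α.CrossedProduct → Prop} (x : α.CrossedProduct)
    (h0 : p 0) (hδ : ∀ g a, p (δ α g a)) (hadd : ∀ x y, p x → p y → p (x + y)) : p x := by
  classical
  refine DirectSum.induction_on (motive := p) x h0 (fun g a => ?_) hadd
  exact hδ g a

theorem δ_congr {g h : G} (e : g = h) {a : α.D g} {b : α.D h} (hab : (a : R) = b) :
    δ α g a = δ α h b := by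
  subst e
  rw [Subtype.ext hab]

/-- `mulCoeff` as a biadditive map into the crossed product. -/
noncomputable def mulδ (g h : G) : α.D g →+ α.D h →+ α.CrossedProduct :=
  AddMonoidHom.mk' (fun a => AddMonoidHom.mk' (fun b => δ α (g * h) (α.mulCoeff g h a b))
    (fun b b' => by
      rw [← map_add]; refine δ_congr α rfl ?_
      change _ = (α.mulCoeff g h a b : R) + α.mulCoeff g h a b'
      simp only [coe_mulCoeff]
      change _ * α.actExt g ((b : R) + b') * _ = _
      rw [map_add, mul_add, add_mul]))
    (fun a a' => by
      ext b
      change δ α (g * h) _ = δ α (g * h) _ + δ α (g * h) _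
      rw [← map_add]; refine δ_congr α rfl ?_
      change _ = (α.mulCoeff g h a b : R) + α.mulCoeff g h a' b
      simp only [coe_mulCoeff]
      change ((a : R) + a') * _ * _ = _
      rw [add_mul, add_mul])

open Classical in
/-- The biadditive extension of `(a δ_g) (b δ_h) = α_g (α_g⁻¹ (a) b) w_{g,h} δ_{gh}`. -/
noncomputable def mulHom : α.CrossedProduct →+ α.CrossedProduct →+ α.CrossedProduct :=
  DirectSum.toAddMonoid fun g => AddMonoidHom.flip <| DirectSum.toAddMonoid fun h =>
    (mulδ α g h).flip

theorem mulHom_δ (g h : G) (a : α.D g) (b : α.D h) :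
    mulHom α (δ α g a) (δ α h b) = δ α (g * h) (α.mulCoeff g h a b) := by
  classical
  unfold mulHom δ
  erw [DirectSum.toAddMonoid_of, AddMonoidHom.flip_apply, DirectSum.toAddMonoid_of]
  rfl

/-- The identity `1_R δ_1`. -/
noncomputable def oneδ : α.CrossedProduct :=
  δ α 1 ⟨1, by rw [α.D_one]; trivial⟩

theorem mulHom_one (x : α.CrossedProduct) : mulHom α x (oneδ α) = x := by
  refine induction α x (by simp) (fun g a => ?_) (fun x y hx hy => by
    rw [map_add, AddMonoidHom.add_apply, hx, hy])
  change mulHom α (δ α g a) (δ α 1 _) = δ α g a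
  rw [mulHom_δ]
  refine δ_congr α (mul_one g) ?_
  rw [coe_mulCoeff, α.w_one_right]
  change (a : R) * α.actExt g 1 * _ = _
  rw [← α.idem_one, α.actExt_idem, mul_one, α.idem_idem, α.mul_idem a.2, α.mul_idem a.2]

theorem one_mulHom (x : α.CrossedProduct) : mulHom α (oneδ α) x = x := by
  refine induction α x (by simp) (fun g a => ?_) (fun x y hx hy => by
    rw [map_add, hx, hy])
  change mulHom α (δ α 1 _) (δ α g a) = δ α g a
  rw [mulHom_δ]
  refine δ_congr α (one_mul g) ?_
  rw [coe_mulCoeff, α.w_one_left, α.actExt_one]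
  change 1 * (a : R) * _ = _
  rw [one_mul, α.mul_idem a.2]

theorem mulHom_assoc (x y z : α.CrossedProduct) :
    mulHom α (mulHom α x y) z = mulHom α x (mulHom α y z) := by
  refine induction α x (by simp) (fun g a => ?_) (fun x x' hx hx' => by
    simp only [map_add, AddMonoidHom.add_apply, hx, hx'])
  refine induction α y (by simp) (fun h b => ?_) (fun y y' hy hy' => by
    simp only [map_add, AddMonoidHom.add_apply, hy, hy'])
  refine induction α z (by simp) (fun t c => ?_) (fun z z' hz hz' => by
    simp only [map_add, hz, hz'])
  rw [mulHom_δ, mulHom_δ, mulHom_δ, mulHom_δ]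
  refine δ_congr α (mul_assoc g h t) ?_
  simp only [coe_mulCoeff, α.actExt_mul, mul_assoc]
  rw [α.actExt_w, ← mul_assoc (α.w g h) (α.actExt (g * h) c), ← α.actExt_ext]
  simp only [mul_assoc]

noncomputable instance : Ring α.CrossedProduct where
  __ := (inferInstance : AddCommGroup α.CrossedProduct)
  mul x y := mulHom α x y
  one := oneδ α
  mul_assoc := mulHom_assoc α
  one_mul := one_mulHom α
  mul_one := mulHom_one α
  left_distrib x y z := map_add (mulHom α x) y z
  right_distrib x y z := DFunLike.congr_fun (map_add (mulHom α) x y) z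
  zero_mul x := DFunLike.congr_fun (map_zero (mulHom α)) x
  mul_zero x := map_zero (mulHom α x)

end CrossedProduct

end UnitalTwistedPartialAction

end TwistedPartialActions

universe u v w

section WeakDimension

/-- The tensor product `M ⊗_R N` of a right `R`-module `M` and a left `R`-module `N` over a
(noncommutative) ring `R`: the quotient of `M ⊗_ℤ N` by the relations `(m r) ⊗ n = m ⊗ (r n)`. -/
abbrev BalancedTensor (R M N : Type*) [Ring R] [AddCommGroup M] [Module Rᵐᵒᵖ M]
    [AddCommGroup N] [Module R N] : Type _ :=
  TensorProduct ℤ M N ⧸ AddSubgroup.closure {x : TensorProduct ℤ M N | ∃ (m : M) (r : R) (n : N),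
    x = TensorProduct.tmul ℤ (MulOpposite.op r • m) n - TensorProduct.tmul ℤ m (r • n)}

/-- The map `M ⊗_R f : M ⊗_R N → M ⊗_R N'` induced by an `R`-linear map `f : N → N'`. -/
def BalancedTensor.lTensor {R : Type*} (M : Type*) {N N' : Type*} [Ring R]
    [AddCommGroup M] [Module Rᵐᵒᵖ M] [AddCommGroup N] [Module R N] [AddCommGroup N'] [Module R N']
    (f : N →ₗ[R] N') : BalancedTensor R M N →+ BalancedTensor R M N' :=
  QuotientAddGroup.map _ _ (LinearMap.lTensor M f.toAddMonoidHom.toIntLinearMap).toAddMonoidHom (by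
    rw [AddSubgroup.closure_le]
    rintro x ⟨m, r, n, rfl⟩
    refine AddSubgroup.subset_closure ⟨m, r, f n, ?_⟩
    rw [map_sub]
    exact congrArg₂ (· - ·) rfl (congrArg (TensorProduct.tmul ℤ m) (f.map_smul r n)))

/-- A right `R`-module `M` is flat if `M ⊗_R -` is an exact functor on left `R`-modules. -/
def IsFlatRightModule (R : Type u) (M : Type v) [Ring R] [AddCommGroup M] [Module Rᵐᵒᵖ M] : Prop :=
  ∀ (N₁ N₂ N₃ : Type (max u v)) [AddCommGroup N₁] [AddCommGroup N₂] [AddCommGroup N₃]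
    [Module R N₁] [Module R N₂] [Module R N₃] (f : N₁ →ₗ[R] N₂) (g : N₂ →ₗ[R] N₃),
    Function.Exact f g →
      Function.Exact (BalancedTensor.lTensor M f) (BalancedTensor.lTensor M g)

/-- The right `R`-module `M` has a flat resolution
`0 → F n → ⋯ → F 1 → F 0 → M → 0` (we put `F i = 0` for `i > n`). -/
def HasFlatResolution (R : Type u) (M : Type v) [Ring R] [AddCommGroup M] [Module Rᵐᵒᵖ M]
    (n : ℕ) : Prop :=
  ∃ (F : ℕ → ModuleCat.{max u v} Rᵐᵒᵖ) (d : ∀ i, F (i + 1) →ₗ[Rᵐᵒᵖ] F i) (ε : F 0 →ₗ[Rᵐᵒᵖ] M),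
    (∀ i, IsFlatRightModule R (F i)) ∧ (∀ i, n < i → Subsingleton (F i)) ∧
    Function.Surjective ε ∧ Function.Exact (d 0) ε ∧
    ∀ i, Function.Exact (d (i + 1)) (d i)

/-- The flat dimension of a right `R`-module: the least length of a flat resolution, and `⊤` if
there is no finite flat resolution. -/
noncomputable def flatDim (R : Type u) (M : Type v) [Ring R] [AddCommGroup M] [Module Rᵐᵒᵖ M] :
    ℕ∞ :=
  ⨅ (n : ℕ) (_ : HasFlatResolution R M n), (n : ℕ∞)

/-- The weak global dimension of `R`: the supremum of the flat dimensions of the right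
`R`-modules. -/
noncomputable def weakGlobalDim (R : Type u) [Ring R] : ℕ∞ :=
  ⨆ M : ModuleCat.{max u w} Rᵐᵒᵖ, flatDim R M

end WeakDimension

/-! Write `S` for the crossed product. A right module is flat exactly when its character module is
injective (Lambek), so by dimension shifting its flat dimension is the injective dimension of its
character module (`hasFlatResolution_iff`). This turns the claim into one about injective dimensions
of left modules.

The ring `S` is a split, separable Frobenius extension of `R` (`splitFrobeniusSystem`): the
Frobenius homomorphism `π` is the coefficient of `δ_1`, the dual bases are `u_g = 1_g δ_g` and their
relative inverses `v_g`, and `∑ u_g c v_g = 1` for any central `c` of trace `∑ α_g(1_{g⁻¹} c) = 1`.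
The Frobenius identities make restriction to `R` preserve injectives, and averaging with weight `c`,
as in Maschke's theorem, makes it reflect them. Character modules commute with restriction, and
since `π` splits the inclusion every right `R`-module is a retract of a restricted `S`-module. Hence
the two dimensions agree.

What is special to partial actions is the existence of `c` (`exists_mem_center_sum_actExt_eq_one`):
the trace of `1` is `∑ 1_g`, which need not be a unit even if `|G|` is. Decompose `1` into the
central idempotents `e_A = ∏_{g ∈ A} 1_g ∏_{g ∉ A} (1 - 1_g)`, `A ⊆ G`. They satisfy `α_g(1_{g⁻¹}
e_A) = e_{gA}` when `1 ∈ A`, so a sum over suitable representatives of the `G`-orbits of subsets,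
weighted by `|G| / |Stab|`, has trace `|G|`. Dividing by `|G|` gives `c`. -/

/-! ### Character modules of right modules -/

section RightDual

/-- The character module of a right `R`-module, as a left `R`-module. -/
def RightDual (R : Type*) (M : Type*) [Ring R] [AddCommGroup M] [Module Rᵐᵒᵖ M] : Type _ :=
  M →+ AddCircle (1 : ℚ)

variable {R : Type*} {M N : Type*} [Ring R] [AddCommGroup M] [Module Rᵐᵒᵖ M]
  [AddCommGroup N] [Module R N]

namespace RightDual

instance : AddCommGroup (RightDual R M) := inferInstanceAs (AddCommGroup (M →+ AddCircle (1 : ℚ)))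

instance : FunLike (RightDual R M) M (AddCircle (1 : ℚ)) :=
  inferInstanceAs (FunLike (M →+ AddCircle (1 : ℚ)) M (AddCircle (1 : ℚ)))

instance : AddMonoidHomClass (RightDual R M) M (AddCircle (1 : ℚ)) :=
  inferInstanceAs (AddMonoidHomClass (M →+ AddCircle (1 : ℚ)) M (AddCircle (1 : ℚ)))

@[ext] theorem ext {f g : RightDual R M} (h : ∀ m, f m = g m) : f = g := DFunLike.ext _ _ h

instance : SMul R (RightDual R M) where
  smul r f := AddMonoidHom.comp (show M →+ AddCircle (1 : ℚ) from f)
    (DistribSMul.toAddMonoidHom M (MulOpposite.op r))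

theorem smul_apply (r : R) (f : RightDual R M) (m : M) : (r • f) m = f (MulOpposite.op r • m) := rfl

instance : Module R (RightDual R M) where
  one_smul f := by ext m; rw [smul_apply, MulOpposite.op_one, one_smul]
  mul_smul r s f := by ext m; simp only [smul_apply, MulOpposite.op_mul, mul_smul]
  smul_zero r := rfl
  smul_add r f g := rfl
  add_smul r s f := by
    ext m; rw [smul_apply, MulOpposite.op_add, add_smul, map_add]; rfl
  zero_smul f := by
    ext m; rw [smul_apply, MulOpposite.op_zero, zero_smul, map_zero]; rfl

/-- The transpose of a map of right modules. -/
def map {M' : Type*} [AddCommGroup M'] [Module Rᵐᵒᵖ M'] (f : M →ₗ[Rᵐᵒᵖ] M') :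
    RightDual R M' →ₗ[R] RightDual R M where
  toFun χ := AddMonoidHom.comp (show M' →+ AddCircle (1 : ℚ) from χ) f.toAddMonoidHom
  map_add' _ _ := rfl
  map_smul' r χ := by
    ext m
    exact congrArg χ (f.map_smul (MulOpposite.op r) m).symm

theorem map_apply {M' : Type*} [AddCommGroup M'] [Module Rᵐᵒᵖ M'] (f : M →ₗ[Rᵐᵒᵖ] M')
    (χ : RightDual R M') (m : M) : map f χ m = χ (f m) := rfl

/-- `AddCircle (1 : ℚ)` is ℚ/ℤ, which is divisible and hence an injective abelian group. -/
theorem exists_extension {A B : Type*} [AddCommGroup A] [AddCommGroup B] (f : A →+ B)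
    (hf : Function.Injective f) (χ : A →+ AddCircle (1 : ℚ)) :
    ∃ χ' : B →+ AddCircle (1 : ℚ), ∀ a, χ' (f a) = χ a := by
  obtain ⟨χ', h⟩ := CharacterModule.dual_surjective_of_injective (R := ℤ) f.toIntLinearMap hf χ
  exact ⟨χ', fun a => DFunLike.congr_fun h a⟩

theorem exists_ne_zero {A : Type*} [AddCommGroup A] (H : AddSubgroup A) {a : A} (ha : a ∉ H) :
    ∃ χ : A →+ AddCircle (1 : ℚ), (∀ x ∈ H, χ x = 0) ∧ χ a ≠ 0 := by
  have h : (QuotientAddGroup.mk a : A ⧸ H) ≠ 0 := by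
    rwa [Ne, QuotientAddGroup.eq_zero_iff]
  obtain ⟨c, hc⟩ := CharacterModule.exists_character_apply_ne_zero_of_ne_zero h
  refine ⟨AddMonoidHom.comp (show A ⧸ H →+ AddCircle (1 : ℚ) from c) (QuotientAddGroup.mk' H),
    fun x hx => ?_, hc⟩
  change c (QuotientAddGroup.mk x) = 0
  rw [(QuotientAddGroup.eq_zero_iff x).2 hx, map_zero]

theorem map_surjective {M' : Type*} [AddCommGroup M'] [Module Rᵐᵒᵖ M'] (f : M →ₗ[Rᵐᵒᵖ] M')
    (hf : Function.Injective f) : Function.Surjective (map f) := fun χ => by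
  obtain ⟨χ', h⟩ := exists_extension f.toAddMonoidHom hf χ
  exact ⟨χ', ext h⟩

theorem map_injective {M' : Type*} [AddCommGroup M'] [Module Rᵐᵒᵖ M'] (f : M →ₗ[Rᵐᵒᵖ] M')
    (hf : Function.Surjective f) : Function.Injective (map f) := fun χ χ' h => by
  ext m
  obtain ⟨m, rfl⟩ := hf m
  exact DFunLike.congr_fun h m

theorem map_exact {M₁ M₂ M₃ : Type*} [AddCommGroup M₁] [Module Rᵐᵒᵖ M₁] [AddCommGroup M₂]
    [Module Rᵐᵒᵖ M₂] [AddCommGroup M₃] [Module Rᵐᵒᵖ M₃] (f : M₁ →ₗ[Rᵐᵒᵖ] M₂) (g : M₂ →ₗ[Rᵐᵒᵖ] M₃)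
    (hg : Function.Surjective g) (h : Function.Exact f g) :
    Function.Exact (map g) (map f) := by
  intro χ
  constructor
  · intro hχ
    refine ⟨(g.toAddMonoidHom.liftOfRightInverse (Function.surjInv hg)
      (Function.rightInverse_surjInv hg)) ⟨χ, fun x hx => ?_⟩, ?_⟩
    · obtain ⟨y, rfl⟩ := (h x).1 hx
      exact DFunLike.congr_fun hχ y
    · ext m
      exact AddMonoidHom.liftOfRightInverse_comp_apply _ _ (Function.rightInverse_surjInv hg) _ m
  · rintro ⟨χ, rfl⟩
    ext m
    rw [map_apply, map_apply, h.apply_apply_eq_zero, map_zero]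
    rfl

end RightDual

/-! ### Adjunction: characters of `M ⊗_R N` and linear maps `N → RightDual R M` -/

namespace BalancedTensor

variable (R) in
/-- The class of `m ⊗ n` in `M ⊗_R N`. -/
def mk (m : M) (n : N) : BalancedTensor R M N := QuotientAddGroup.mk (TensorProduct.tmul ℤ m n)

theorem hom_ext {A : Type*} [AddCommGroup A] {f g : BalancedTensor R M N →+ A}
    (h : ∀ m n, f (mk R m n) = g (mk R m n)) : f = g := by
  refine QuotientAddGroup.addMonoidHom_ext _ (AddMonoidHom.ext fun x => ?_)
  induction x with
  | zero => simp
  | tmul m n => exact h m n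
  | add x y hx hy => rw [map_add, map_add, hx, hy]

theorem lTensor_mk {N' : Type*} [AddCommGroup N'] [Module R N'] (f : N →ₗ[R] N') (m : M) (n : N) :
    lTensor M f (mk R m n) = mk R m (f n) := rfl

theorem mk_add (m : M) (n n' : N) : mk R m (n + n') = mk R m n + mk R m n' := by
  unfold mk; rw [TensorProduct.tmul_add]; rfl

theorem add_mk (m m' : M) (n : N) : mk R (m + m') n = mk R m n + mk R m' n := by
  unfold mk; rw [TensorProduct.add_tmul]; rfl

theorem smul_mk (m : M) (r : R) (n : N) : mk R (MulOpposite.op r • m) n = mk R m (r • n) := by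
  refine (QuotientAddGroup.eq_iff_sub_mem).2 (AddSubgroup.subset_closure ⟨m, r, n, rfl⟩)

/-- The character of `M ⊗_R N` given by a linear map from `N` to the dual of `M`. -/
def lift (φ : N →ₗ[R] RightDual R M) : BalancedTensor R M N →+ AddCircle (1 : ℚ) :=
  QuotientAddGroup.lift _ (TensorProduct.liftAddHom
    (AddMonoidHom.flip (show N →+ M →+ AddCircle (1 : ℚ) from φ.toAddMonoidHom))
    (fun z m n => by
      simp)) (by
    rw [AddSubgroup.closure_le]
    rintro x ⟨m, r, n, rfl⟩
    change TensorProduct.liftAddHom _ _ _ = 0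
    rw [map_sub, sub_eq_zero, TensorProduct.liftAddHom_tmul, TensorProduct.liftAddHom_tmul]
    exact (DFunLike.congr_fun (φ.map_smul r n) m).symm)

theorem lift_mk (φ : N →ₗ[R] RightDual R M) (m : M) (n : N) : lift φ (mk R m n) = φ n m := rfl

/-- The linear map from `N` to the dual of `M` given by a character of `M ⊗_R N`. -/
def curry (χ : BalancedTensor R M N →+ AddCircle (1 : ℚ)) : N →ₗ[R] RightDual R M where
  toFun n := AddMonoidHom.mk' (fun m => χ (mk R m n)) (fun m m' => by rw [add_mk, map_add])
  map_add' n n' := by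
    refine RightDual.ext fun m => ?_
    change χ (mk R m (n + n')) = χ (mk R m n) + χ (mk R m n')
    rw [mk_add, map_add]
  map_smul' r n := by
    refine RightDual.ext fun m => ?_
    change χ (mk R m (r • n)) = χ (mk R (MulOpposite.op r • m) n)
    rw [smul_mk]

theorem curry_apply (χ : BalancedTensor R M N →+ AddCircle (1 : ℚ)) (n : N) (m : M) :
    curry χ n m = χ (mk R m n) := rfl

end BalancedTensor

end RightDual

/-! ### Lambek's criterion: flatness and injectivity of the character module -/

section Lambek

variable {R : Type u} {M : Type (max u w)} [Ring R] [AddCommGroup M] [Module Rᵐᵒᵖ M]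

open BalancedTensor CategoryTheory

/-- By adjunction, extending `φ` from `A` to `B` amounts to extending a character from `M ⊗ A` to `M
⊗ B`, which is possible once `M ⊗ f` is injective. -/
theorem IsFlatRightModule.injective_rightDual (h : IsFlatRightModule.{u, max u w} R M) :
    Module.Injective R (RightDual R M) := by
  refine ⟨fun A B _ _ _ _ f hf φ => ?_⟩
  -- Flatness is stated for sequences exact in the middle; prefixing the zero module yields
  -- preservation of injectivity.
  have hex : Function.Exact (0 : PUnit.{(max u w) + 1} →ₗ[R] A) f := by
    intro a
    rw [map_eq_zero_iff f hf]
    exact ⟨fun h => ⟨0, h.symm⟩, fun ⟨_, h⟩ => h.symm⟩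
  have hinj : Function.Injective (lTensor M f) := by
    rw [injective_iff_map_eq_zero]
    intro x hx
    obtain ⟨y, rfl⟩ := (h _ _ _ _ _ hex x).1 hx
    have : lTensor M (0 : PUnit.{(max u w) + 1} →ₗ[R] A) = 0 :=
      hom_ext fun m n => by
        rw [lTensor_mk, LinearMap.zero_apply, AddMonoidHom.zero_apply]
        have := mk_add (R := R) m (0 : A) 0
        simpa using this
    rw [this, AddMonoidHom.zero_apply]
  obtain ⟨χ, hχ⟩ := RightDual.exists_extension _ hinj (lift φ)
  refine ⟨curry χ, fun a => RightDual.ext fun m => ?_⟩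
  rw [curry_apply, ← lTensor_mk, hχ, lift_mk]

/-- An element killed by `M ⊗ g` but outside the range of `M ⊗ f` is detected by a character `χ`
vanishing on that range. The curried `χ` kills `ker g`, so it factors through the range of `g` and
extends to `C` by injectivity. Thus `χ` factors through `M ⊗ g`, a contradiction. -/
theorem isFlatRightModule_of_injective_rightDual (h : Module.Injective R (RightDual R M)) :
    IsFlatRightModule.{u, max u w} R M := by
  intro A B C _ _ _ _ _ _ f g hfg x
  constructor
  · intro hx
    by_contra hne
    obtain ⟨χ, hχ, hχx⟩ := RightDual.exists_ne_zero (lTensor M f).range (a := x) hne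
    have hk : LinearMap.ker g ≤ LinearMap.ker (curry χ) := by
      intro b hb
      obtain ⟨a, rfl⟩ := (hfg b).1 hb
      exact RightDual.ext fun m => hχ _ ⟨mk R m a, rfl⟩
    obtain ⟨ψ, hψ⟩ := h.out (LinearMap.range g).subtype (Submodule.subtype_injective _)
      ((Submodule.liftQ _ (curry χ) hk).comp g.quotKerEquivRange.symm.toLinearMap)
    have key : χ = (lift ψ).comp (lTensor M g) := by
      refine hom_ext fun m b => ?_
      have h1 := hψ ⟨g b, ⟨b, rfl⟩⟩
      have h2 : g.quotKerEquivRange.symm ⟨g b, ⟨b, rfl⟩⟩ = Submodule.Quotient.mk b := by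
        rw [LinearEquiv.symm_apply_eq]; rfl
      rw [LinearMap.comp_apply, LinearEquiv.coe_coe, h2] at h1
      exact (DFunLike.congr_fun h1 m).symm
    refine hχx ?_
    rw [key, AddMonoidHom.comp_apply, hx, map_zero]
  · rintro ⟨y, rfl⟩
    have : (lTensor M g).comp (lTensor M f) = 0 := hom_ext fun m a => by
      change mk R m (g (f a)) = 0
      rw [hfg.apply_apply_eq_zero]
      have := mk_add (R := R) m (0 : C) 0
      simpa using this
    exact DFunLike.congr_fun this y

theorem isFlatRightModule_iff_injective :
    IsFlatRightModule.{u, max u w} R M ↔ Injective (ModuleCat.of R (RightDual R M)) := by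
  rw [← Module.injective_iff_injective_object]
  exact ⟨fun h => h.injective_rightDual, isFlatRightModule_of_injective_rightDual⟩

end Lambek

/-! ### Flat dimension as injective dimension of the character module -/

section FlatDimension

open CategoryTheory

theorem hasFlatResolution_of_flat {R : Type u} [Ring R] (M : Type (max u w)) [AddCommGroup M]
    [Module Rᵐᵒᵖ M] (hM : IsFlatRightModule.{u, max u w} R M) :
    HasFlatResolution.{u, max u w} R M 0 := by
  refine ⟨fun | 0 => ModuleCat.of _ M | _ + 1 => ModuleCat.of _ PUnit, fun _ => 0,
    LinearMap.id, ?_, ?_, Function.surjective_id, ?_, ?_⟩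
  · rintro (_ | i)
    · exact hM
    · refine isFlatRightModule_of_injective_rightDual ⟨fun A B _ _ _ _ f hf φ => ⟨0, fun a => ?_⟩⟩
      refine RightDual.ext fun m => ?_
      exact (map_zero (φ a)).symm
  · rintro (_ | i) hi
    · exact absurd hi (lt_irrefl 0)
    · exact inferInstanceAs (Subsingleton PUnit)
  · exact fun x => ⟨fun h => ⟨0, h.symm⟩, fun ⟨_, h⟩ => h.symm⟩
  · exact fun i x => ⟨fun h => ⟨0, rfl⟩, fun _ => rfl⟩

theorem HasFlatResolution.succ {R : Type u} [Ring R] {M P : Type (max u w)} [AddCommGroup M]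
    [Module Rᵐᵒᵖ M] [AddCommGroup P] [Module Rᵐᵒᵖ P] (hP : IsFlatRightModule.{u, max u w} R P)
    (g : P →ₗ[Rᵐᵒᵖ] M) (hg : Function.Surjective g) {n : ℕ}
    (h : HasFlatResolution.{u, max u w} R (LinearMap.ker g) n) :
    HasFlatResolution.{u, max u w} R M (n + 1) := by
  obtain ⟨F, d, ε, hF, hs, hε, h0, hd⟩ := h
  refine ⟨fun | 0 => ModuleCat.of _ P | i + 1 => F i,
    fun | 0 => (LinearMap.ker g).subtype.comp ε | i + 1 => d i, g, ?_, ?_, hg, ?_, ?_⟩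
  · rintro (_ | i)
    exacts [hP, hF i]
  · rintro (_ | i) hi
    · exact absurd hi (Nat.not_lt_zero _)
    · exact hs i (Nat.lt_of_succ_lt_succ hi)
  · intro x
    constructor
    · intro hx
      obtain ⟨y, hy⟩ := hε ⟨x, hx⟩
      exact ⟨y, congrArg Subtype.val hy⟩
    · rintro ⟨y, rfl⟩
      exact (ε y).2
  · rintro (_ | i)
    · intro x
      refine Iff.trans ?_ (h0 x)
      exact (Submodule.coe_eq_zero (x := ε x))
    · exact hd i

theorem HasFlatResolution.ker {R : Type u} [Ring R] {M : Type (max u w)} [AddCommGroup M]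
    [Module Rᵐᵒᵖ M] {n : ℕ} (h : HasFlatResolution.{u, max u w} R M (n + 1)) :
    ∃ (P : ModuleCat.{max u w} Rᵐᵒᵖ) (g : P →ₗ[Rᵐᵒᵖ] M), IsFlatRightModule.{u, max u w} R P ∧
      Function.Surjective g ∧ HasFlatResolution.{u, max u w} R (LinearMap.ker g) n := by
  obtain ⟨F, d, ε, hF, hs, hε, h0, hd⟩ := h
  refine ⟨F 0, ε, hF 0, hε, fun i => F (i + 1), fun i => d (i + 1),
    (d 0).codRestrict _ fun x => h0.apply_apply_eq_zero x, fun i => hF _,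
    fun i hi => hs _ (Nat.succ_lt_succ hi), ?_, ?_, fun i => hd (i + 1)⟩
  · rintro ⟨x, hx⟩
    obtain ⟨y, rfl⟩ := (h0 x).1 hx
    exact ⟨y, rfl⟩
  · intro x
    refine Iff.trans ?_ (hd 0 x)
    exact (Submodule.coe_eq_zero (x := (d 0).codRestrict (LinearMap.ker ε) _ x)).symm

theorem HasFlatResolution.exists_flat_equiv {R : Type u} [Ring R] {M : Type (max u w)}
    [AddCommGroup M] [Module Rᵐᵒᵖ M] (h : HasFlatResolution.{u, max u w} R M 0) :
    ∃ (P : ModuleCat.{max u w} Rᵐᵒᵖ) (g : P →ₗ[Rᵐᵒᵖ] M), IsFlatRightModule.{u, max u w} R P ∧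
      Function.Bijective g := by
  obtain ⟨F, d, ε, hF, hs, hε, h0, -⟩ := h
  refine ⟨F 0, ε, hF 0, ?_, hε⟩
  rw [injective_iff_map_eq_zero]
  intro x hx
  obtain ⟨y, rfl⟩ := (h0 x).1 hx
  have := hs 1 one_pos
  rw [Subsingleton.elim y 0, map_zero]

/-- A linear map into the dual of a free module is determined by the additive functionals `a ↦ φ a
(single i 1)`, one for each `i`. These extend to `B` independently, since ℚ/ℤ is injective. -/
theorem isFlatRightModule_finsupp {R : Type u} [Ring R] (ι : Type (max u w)) :
    IsFlatRightModule.{u, max u w} R (ι →₀ Rᵐᵒᵖ) := by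
  refine isFlatRightModule_of_injective_rightDual ⟨fun A B _ _ _ _ f hf φ => ?_⟩
  have hext : ∀ i : ι, ∃ ψ : B →+ AddCircle (1 : ℚ),
      ∀ a, ψ (f a) = φ a (Finsupp.single i 1) := fun i =>
    RightDual.exists_extension f.toAddMonoidHom hf
      (AddMonoidHom.mk' (fun a => φ a (Finsupp.single i 1)) fun a a' => by rw [map_add]; rfl)
  choose ψ hψ using hext
  let Ψ : B → (ι →₀ Rᵐᵒᵖ) →+ AddCircle (1 : ℚ) := fun b => Finsupp.liftAddHom fun i =>
    (ψ i).comp (AddMonoidHom.mk' (fun r : Rᵐᵒᵖ => r.unop • b) fun r s => add_smul _ _ _)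
  have hΨ : ∀ b i r, Ψ b (Finsupp.single i r) = ψ i (r.unop • b) := fun b i r =>
    Finsupp.liftAddHom_apply_single _ _ _
  refine ⟨{ toFun := Ψ, map_add' := fun b b' => ?_, map_smul' := fun r b => ?_ }, fun a => ?_⟩
  · refine Finsupp.addHom_ext fun i s => ?_
    change _ = Ψ b _ + Ψ b' _
    rw [hΨ, hΨ, hΨ, smul_add, map_add]
  · refine Finsupp.addHom_ext fun i s => ?_
    change _ = Ψ b (MulOpposite.op r • Finsupp.single i s)
    rw [Finsupp.smul_single, hΨ, hΨ, smul_smul]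
    rfl
  · refine Finsupp.addHom_ext fun i s => ?_
    change Ψ (f a) _ = φ a _
    rw [hΨ, ← map_smul, hψ, map_smul, RightDual.smul_apply, Finsupp.smul_single]
    simp

theorem RightDual.shortExact {R : Type u} [Ring R] {M P : Type (max u w)} [AddCommGroup M]
    [Module Rᵐᵒᵖ M] [AddCommGroup P] [Module Rᵐᵒᵖ P] (g : P →ₗ[Rᵐᵒᵖ] M)
    (hg : Function.Surjective g) :
    (ShortComplex.mk (ModuleCat.ofHom (RightDual.map g))
      (ModuleCat.ofHom (RightDual.map (LinearMap.ker g).subtype)) (by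
        ext χ
        exact (RightDual.map_exact (LinearMap.ker g).subtype g hg
          (LinearMap.exact_subtype_ker_map g)).apply_apply_eq_zero χ)).ShortExact := by
  refine ShortComplex.ShortExact.mk' ?_ ?_ ?_
  · rw [ShortComplex.ShortExact.moduleCat_exact_iff_function_exact]
    exact RightDual.map_exact _ g hg (LinearMap.exact_subtype_ker_map g)
  · rw [ModuleCat.mono_iff_injective]
    exact RightDual.map_injective g hg
  · rw [ModuleCat.epi_iff_surjective]
    exact RightDual.map_surjective _ (Submodule.subtype_injective _)

/-- Dimension shifting: for a surjection `g` from a flat `P`, the dual of `P` is injective, so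
passing from the dual of `M` to that of `ker g` lowers the bound by one. Given a resolution, `P` is
its first term; conversely `P` is the free module on the set `M`. -/
theorem hasFlatResolution_iff {R : Type u} [Ring R] (M : Type (max u w)) [AddCommGroup M]
    [Module Rᵐᵒᵖ M] (n : ℕ) : HasFlatResolution.{u, max u w} R M n ↔
      HasInjectiveDimensionLE (ModuleCat.of R (RightDual R M)) n := by
  induction n generalizing M with
  | zero =>
    constructor
    · intro h
      obtain ⟨P, g, hP, hg⟩ := h.exists_flat_equiv
      have := isFlatRightModule_iff_injective.1 hP
      exact hasInjectiveDimensionLT_of_iso (LinearEquiv.ofBijective (RightDual.map g)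
        ⟨RightDual.map_injective g hg.2, RightDual.map_surjective g hg.1⟩).toModuleIso.symm 1
    · intro h
      exact hasFlatResolution_of_flat M
        (isFlatRightModule_iff_injective.2 (injective_iff_hasInjectiveDimensionLT_one.2 h))
  | succ n ih =>
    constructor
    · intro h
      obtain ⟨P, g, hP, hg, hk⟩ := h.ker
      exact ((RightDual.shortExact g hg).hasInjectiveDimensionLT_X₃_iff n
        (isFlatRightModule_iff_injective.1 hP)).1 ((ih _).1 hk)
    · intro h
      have hP := isFlatRightModule_finsupp.{u, w} (R := R) M
      let g : (M →₀ Rᵐᵒᵖ) →ₗ[Rᵐᵒᵖ] M := Finsupp.linearCombination Rᵐᵒᵖ id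
      have hg : Function.Surjective g := Finsupp.linearCombination_id_surjective _ _
      exact HasFlatResolution.succ hP g hg ((ih _).2
        (((RightDual.shortExact g hg).hasInjectiveDimensionLT_X₃_iff n
        (isFlatRightModule_iff_injective.1 hP)).2 h))

theorem flatDim_le_iff {R : Type u} [Ring R] (M : Type (max u w)) [AddCommGroup M]
    [Module Rᵐᵒᵖ M] (n : ℕ) : flatDim.{u, max u w} R M ≤ n ↔
      HasInjectiveDimensionLE (ModuleCat.of R (RightDual R M)) n := by
  constructor
  · intro h
    -- If every length of a resolution exceeded `n`, the infimum would be at least `n + 1`.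
    have : ∃ m, HasFlatResolution.{u, max u w} R M m ∧ m ≤ n := by
      by_contra! hn
      have h2 : ((n + 1 : ℕ) : ℕ∞) ≤ flatDim.{u, max u w} R M :=
        le_iInf fun m => le_iInf fun hm => by exact_mod_cast hn m hm
      have h3 := h2.trans h
      norm_cast at h3
      omega
    obtain ⟨m, hm, hmn⟩ := this
    have := (hasFlatResolution_iff M m).1 hm
    exact hasInjectiveDimensionLT_of_ge _ (m + 1) (n + 1) (by omega)
  · exact fun h => iInf₂_le n ((hasFlatResolution_iff M n).2 h)

theorem weakGlobalDim_le_iff {R : Type u} [Ring R] (n : ℕ) : weakGlobalDim.{u, w} R ≤ n ↔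
    ∀ M : ModuleCat.{max u w} Rᵐᵒᵖ,
      HasInjectiveDimensionLE (ModuleCat.of R (RightDual R M)) n :=
  iSup_le_iff.trans (forall_congr' fun M => flatDim_le_iff M n)

end FlatDimension

/-! ### Injective dimension along split separable Frobenius extensions -/

section FrobeniusExtension

open CategoryTheory

theorem shortExact_map_restrictScalars {R : Type*} {S : Type*} [Ring R] [Ring S] (f : R →+* S)
    {T : ShortComplex (ModuleCat.{v} S)} (hT : T.ShortExact) :
    (T.map (ModuleCat.restrictScalars.{v} f)).ShortExact := by
  refine ShortComplex.ShortExact.mk' ?_ ?_ ?_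
  · have := (ShortComplex.ShortExact.moduleCat_exact_iff_function_exact _).1 hT.exact
    exact (ShortComplex.ShortExact.moduleCat_exact_iff_function_exact _).2 this
  · exact (ModuleCat.mono_iff_injective _).2 hT.moduleCat_injective_f
  · exact (ModuleCat.epi_iff_surjective _).2 hT.moduleCat_surjective_g

/-- An `R`-bimodule retraction of a ring extension `f : R → S`. -/
structure BimoduleRetraction {R : Type*} {S : Type*} [Ring R] [Ring S] (f : R →+* S) where
  π : S →+ R
  π_left : ∀ r s, π (f r * s) = r * π s
  π_right : ∀ r s, π (s * f r) = π s * r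
  π_one : π 1 = 1

namespace BimoduleRetraction

variable {R : Type u} {S : Type (max u v)} [Ring R] [Ring S] {f : R →+* S}

/-- The retraction of the opposite extension. -/
def op (E : BimoduleRetraction f) : BimoduleRetraction (RingHom.op f) where
  π := AddMonoidHom.mk' (fun s => MulOpposite.op (E.π s.unop)) fun s t => by
    rw [MulOpposite.unop_add, map_add, MulOpposite.op_add]
  π_left r s := congrArg MulOpposite.op (E.π_right r.unop s.unop)
  π_right r s := congrArg MulOpposite.op (E.π_left r.unop s.unop)
  π_one := congrArg MulOpposite.op E.π_one

variable (E : BimoduleRetraction f)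

/-- The `R`-linear map `b ↦ (s ↦ π s • b)` into the coextension of scalars. -/
noncomputable def toCoextend (B : ModuleCat.{max u v w} R) :
    B →+ (ModuleCat.coextendScalars.{u, max u v, max u v w} f).obj B :=
  AddMonoidHom.mk' (fun b => (ModuleCat.CoextendScalars.equiv f B).symm
    { toFun := fun s : S => E.π s • b
      map_add' := fun s t : S => by rw [← add_smul, ← map_add]; rfl
      map_smul' := fun r (s : S) => by
        rw [RingHom.id_apply, ← mul_smul, ← E.π_left]; rfl })
    fun b b' => ModuleCat.CoextendScalars.ext (LinearMap.ext fun s : S => smul_add (E.π s) b b')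

theorem toCoextend_apply (B : ModuleCat.{max u v w} R) (b : B) (s : S) :
    ModuleCat.CoextendScalars.equiv f B (E.toCoextend B b) s = E.π s • b := rfl

theorem toCoextend_smul (B : ModuleCat.{max u v w} R) (r : R) (b : B) :
    E.toCoextend B (r • b) = f r • E.toCoextend B b := by
  refine ModuleCat.CoextendScalars.ext (LinearMap.ext fun s : S => ?_)
  refine Eq.trans ?_ (ModuleCat.CoextendScalars.smul_apply f B _ (f r) s).symm
  rw [toCoextend_apply]
  refine Eq.trans ?_ (E.toCoextend_apply B b (s * f r)).symm
  rw [E.π_right, mul_smul]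

theorem coextend_smul_apply_one (B : ModuleCat.{max u v w} R)
    (h : (ModuleCat.coextendScalars.{u, max u v, max u v w} f).obj B) (r : R) :
    ModuleCat.CoextendScalars.equiv f B (f r • h) (1 : S) =
      r • ModuleCat.CoextendScalars.equiv f B h (1 : S) := by
  rw [ModuleCat.CoextendScalars.smul_apply]
  refine Eq.trans ?_ ((ModuleCat.CoextendScalars.equiv f B h).map_smul r _)
  exact congrArg (ModuleCat.CoextendScalars.equiv f B h) ((one_mul (f r)).trans (mul_one (f r)).symm)

/-- Every `R`-module is a retract of the restriction of its coextension. -/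
noncomputable def retract (B : ModuleCat.{max u v w} R) :
    Retract B ((ModuleCat.restrictScalars f).obj
      ((ModuleCat.coextendScalars.{u, max u v, max u v w} f).obj B)) where
  i := ModuleCat.ofHom (X := B) (Y := (ModuleCat.restrictScalars f).obj
      ((ModuleCat.coextendScalars.{u, max u v, max u v w} f).obj B))
    { toFun := E.toCoextend B
      map_add' := (E.toCoextend B).map_add
      map_smul' := E.toCoextend_smul B }
  r := ModuleCat.ofHom (Y := B) (X := (ModuleCat.restrictScalars f).obj
      ((ModuleCat.coextendScalars.{u, max u v, max u v w} f).obj B))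
    { toFun := fun h => ModuleCat.CoextendScalars.equiv f B h (1 : S)
      map_add' := fun h h' => rfl
      map_smul' := fun r h => coextend_smul_apply_one B h r }
  retract := by
    ext b
    change E.π 1 • b = b
    rw [E.π_one, one_smul]

end BimoduleRetraction

/-- A Frobenius system for a ring extension `f : R → S` whose Frobenius homomorphism `π` splits `f`,
together with a central weight `c` that makes the extension separable. The element
`∑ i, u i ⊗ v i` of `S ⊗_R S` commutes with `S`, which is expressed by matrices over `R`. -/
structure SplitFrobeniusSystem {R : Type*} {S : Type*} [Ring R] [Ring S] (f : R →+* S)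
    (I : Type*) [Fintype I] extends BimoduleRetraction f where
  u : I → S
  v : I → S
  c : R
  c_mem_center : c ∈ Subring.center R
  exists_matrix : ∀ s : S, ∃ a : I → I → R, (∀ i, v i * s = ∑ j, f (a i j) * v j) ∧
    ∀ j, s * u j = ∑ i, u i * f (a i j)
  sum_u_π_v : ∑ i, u i * f (π (v i)) = 1
  sum_u_c_v : ∑ i, u i * f c * v i = 1

namespace SplitFrobeniusSystem

variable {R : Type u} {S : Type (max u v)} [Ring R] [Ring S] {f : R →+* S} {I : Type*} [Fintype I]
  (F : SplitFrobeniusSystem f I)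

/-- The `S`-linear map `a ↦ ∑ i, u i • φ (v i • a)` attached to an `R`-linear map `φ`. -/
def average {A X : Type*} [AddCommGroup A] [AddCommGroup X] [Module S A] [Module S X] (φ : A →+ X)
    (hφ : ∀ r a, φ (f r • a) = f r • φ a) : A →ₗ[S] X where
  toFun a := ∑ i, F.u i • φ (F.v i • a)
  map_add' a a' := by simp only [smul_add, map_add, Finset.sum_add_distrib]
  map_smul' s a := by
    -- The matrix carries `s` from the `v`-side to the `u`-side, its entries crossing `φ` by
    -- `R`-linearity.
    obtain ⟨m, h1, h2⟩ := F.exists_matrix s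
    simp only [← mul_smul, h1, Finset.sum_smul, map_sum, Finset.smul_sum, RingHom.id_apply, h2]
    rw [Finset.sum_comm]
    simp only [mul_smul, hφ]

theorem sum_u_c_v_smul {X : Type*} [AddCommGroup X] [Module S X] (x : X) :
    ∑ i, F.u i • f F.c • F.v i • x = x := by
  simp only [← mul_smul, ← mul_assoc]
  rw [← Finset.sum_smul, F.sum_u_c_v, one_smul]

theorem sum_u_π_v_smul {X : Type*} [AddCommGroup X] [Module S X] (x : X) :
    ∑ i, F.u i • f (F.π (F.v i)) • x = x := by
  simp only [← mul_smul]
  rw [← Finset.sum_smul, F.sum_u_π_v, one_smul]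

theorem average_apply {A X : Type*} [AddCommGroup A] [AddCommGroup X] [Module S A] [Module S X]
    (φ : A →+ X) (hφ : ∀ r a, φ (f r • a) = f r • φ a) (a : A) :
    F.average φ hφ a = ∑ i, F.u i • φ (F.v i • a) := rfl

include F in
-- Maschke's argument: extend `g` over `R`, then average the extension with weight `c`. On the image
-- of `i` the average is still `g`, because `∑ u c v = 1`.
theorem injective_of_injective_restrictScalars (X : ModuleCat.{max u v w} S)
    (h : Injective ((ModuleCat.restrictScalars f).obj X)) : Injective X := by
  refine ⟨fun {A B} g i _ => ?_⟩
  let ψ := Injective.factorThru ((ModuleCat.restrictScalars f).map g)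
    ((ModuleCat.restrictScalars f).map i)
  have hψ : ∀ a : A, ψ.hom (i.hom a) = g.hom a := fun a =>
    congrArg (fun k => k.hom a) (Injective.comp_factorThru ((ModuleCat.restrictScalars f).map g)
      ((ModuleCat.restrictScalars f).map i))
  let φ : B →+ X := AddMonoidHom.mk' (fun b => f F.c • (ψ.hom b : X)) fun b b' => by
    refine (congrArg (fun x : X => f F.c • x) (ψ.hom.map_add b b')).trans ?_
    exact smul_add (f F.c) (ψ.hom b : X) (ψ.hom b' : X)
  -- Centrality of `c` keeps the weighted map `R`-linear, as averaging requires.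
  have hφ : ∀ (r : R) (b : B), φ (f r • b) = f r • φ b := fun r b => by
    refine (congrArg (fun x : X => f F.c • x) (ψ.hom.map_smul r b)).trans ?_
    change f F.c • f r • (ψ.hom b : X) = f r • f F.c • (ψ.hom b : X)
    rw [smul_smul, smul_smul, ← map_mul, ← map_mul, (Subring.mem_center_iff.1 F.c_mem_center r)]
  refine ⟨ModuleCat.ofHom (F.average φ hφ), ?_⟩
  ext a
  change ∑ j, F.u j • f F.c • (ψ.hom (F.v j • i.hom a) : X) = g.hom a
  have h2 : ∀ j, (ψ.hom (F.v j • i.hom a) : X) = F.v j • g.hom a := fun j => by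
    rw [← map_smul, hψ, map_smul]
  simp only [h2]
  exact F.sum_u_c_v_smul (X := X) (g.hom a)

include F in
-- Averaging evaluation at `1` followed by `g` gives an `S`-linear map from the coextension of `A`
-- to `X`. Coextension preserves monomorphisms, so this map extends to the coextension of `B`, and
-- `toCoextend` pulls the extension back to `B`. On `A` the result is `∑ u π(v) • g a = g a`.
theorem injective_restrictScalars (X : ModuleCat.{max u v w} S) [Injective X] :
    Injective ((ModuleCat.restrictScalars f).obj X) := by
  refine ⟨fun {A B} g i _ => ?_⟩
  let φ : (ModuleCat.coextendScalars f).obj A →+ X :=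
    AddMonoidHom.mk' (fun h => (g.hom (ModuleCat.CoextendScalars.equiv f A h (1 : S)) : X))
      fun h h' => g.hom.map_add _ _
  have hφ : ∀ (r : R) (h), φ (f r • h) = f r • φ h := fun r h => by
    change (g.hom (ModuleCat.CoextendScalars.equiv f A (f r • h) (1 : S)) : X) = _
    rw [BimoduleRetraction.coextend_smul_apply_one, map_smul]
    rfl
  have : Mono ((ModuleCat.coextendScalars f).map i) := by
    rw [ModuleCat.mono_iff_injective]
    intro x y hxy
    refine ModuleCat.CoextendScalars.ext (LinearMap.ext fun s : S => ?_)
    refine (ModuleCat.mono_iff_injective i).1 inferInstance ?_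
    exact DFunLike.congr_fun (congrArg (ModuleCat.CoextendScalars.equiv f B) hxy) s
  let Φ : (ModuleCat.coextendScalars f).obj A ⟶ X := ModuleCat.ofHom (F.average φ hφ)
  let Ψ := Injective.factorThru Φ ((ModuleCat.coextendScalars f).map i)
  have hΨ : ∀ h, Ψ.hom (((ModuleCat.coextendScalars f).map i).hom h) = F.average φ hφ h := fun h =>
    congrArg (fun k => k.hom h) (Injective.comp_factorThru Φ ((ModuleCat.coextendScalars f).map i))
  refine ⟨ModuleCat.ofHom (X := B) (Y := (ModuleCat.restrictScalars f).obj X)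
    { toFun := fun b => Ψ.hom (F.toCoextend B b)
      map_add' := fun b b' => by rw [map_add, map_add]; rfl
      map_smul' := fun r b => by rw [BimoduleRetraction.toCoextend_smul, map_smul]; rfl }, ?_⟩
  ext a
  change Ψ.hom (F.toCoextend B (i.hom a)) = g.hom a
  have h1 : F.toCoextend B (i.hom a) =
      ((ModuleCat.coextendScalars f).map i).hom (F.toCoextend A a) :=
    ModuleCat.CoextendScalars.ext (LinearMap.ext fun s : S => (map_smul i.hom (F.π s) a).symm)
  rw [h1, hΨ, average_apply]
  have h2 : ∀ j, φ (F.v j • F.toCoextend A a) = f (F.π (F.v j)) • (g.hom a : X) := fun j => by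
    change (g.hom (ModuleCat.CoextendScalars.equiv f A (F.v j • F.toCoextend A a) (1 : S)) : X) = _
    rw [ModuleCat.CoextendScalars.smul_apply, BimoduleRetraction.toCoextend_apply, one_mul, map_smul]
    rfl
  simp only [h2]
  exact F.sum_u_π_v_smul (X := X) (g.hom a)

include F in
-- Restriction is exact and preserves injectives, so an embedding into an injective shifts dimension
-- over both rings at once; the base case is that injectivity is preserved and reflected.
theorem hasInjectiveDimensionLE_restrictScalars_iff (n : ℕ) (X : ModuleCat.{max u v w} S) :
    HasInjectiveDimensionLE ((ModuleCat.restrictScalars f).obj X) n ↔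
      HasInjectiveDimensionLE X n := by
  induction n generalizing X with
  | zero =>
    refine injective_iff_hasInjectiveDimensionLT_one.symm.trans
      (Iff.trans ?_ injective_iff_hasInjectiveDimensionLT_one)
    exact ⟨F.injective_of_injective_restrictScalars X, fun _ => F.injective_restrictScalars X⟩
  | succ n ih =>
    have : EnoughInjectives (ModuleCat.{max u v w} S) := ModuleCat.enoughInjectives.{max u v w} S
    let T := ShortComplex.mk (Injective.ι X) (Limits.cokernel.π (Injective.ι X))
      (Limits.cokernel.condition _)
    have hT : T.ShortExact := ShortComplex.ShortExact.mk' (ShortComplex.exact_cokernel _)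
      inferInstance inferInstance
    have hT' := shortExact_map_restrictScalars f hT
    have e1 := hT.hasInjectiveDimensionLT_X₃_iff n (inferInstanceAs (Injective (Injective.under X)))
    have e2 := hT'.hasInjectiveDimensionLT_X₃_iff n
      (F.injective_restrictScalars (Injective.under X))
    exact e2.symm.trans ((ih _).trans e1)

/-- The character module of a restricted module is the restriction of the character module. -/
noncomputable def rightDualRestrictScalarsIso (f : R →+* S) (M : ModuleCat.{w} Sᵐᵒᵖ) :
    (ModuleCat.restrictScalars f).obj (ModuleCat.of S (RightDual S M)) ≅
      ModuleCat.of R (RightDual R ((ModuleCat.restrictScalars (RingHom.op f)).obj M)) where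
  hom := ModuleCat.ofHom (X := (ModuleCat.restrictScalars f).obj (ModuleCat.of S (RightDual S M)))
    (Y := RightDual R ((ModuleCat.restrictScalars (RingHom.op f)).obj M))
    { toFun := fun χ => χ
      map_add' := fun _ _ => rfl
      map_smul' := fun _ _ => rfl }
  inv := ModuleCat.ofHom (Y := (ModuleCat.restrictScalars f).obj (ModuleCat.of S (RightDual S M)))
    (X := RightDual R ((ModuleCat.restrictScalars (RingHom.op f)).obj M))
    { toFun := fun χ => χ
      map_add' := fun _ _ => rfl
      map_smul' := fun _ _ => rfl }

include F in
theorem hasInjectiveDimensionLE_rightDual_iff (n : ℕ) (M : ModuleCat.{max u v w} Sᵐᵒᵖ) :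
    HasInjectiveDimensionLE
        (ModuleCat.of R (RightDual R ((ModuleCat.restrictScalars (RingHom.op f)).obj M))) n ↔
      HasInjectiveDimensionLE (ModuleCat.of S (RightDual S M)) n := by
  rw [← F.hasInjectiveDimensionLE_restrictScalars_iff]
  exact ⟨fun _ => hasInjectiveDimensionLT_of_iso (rightDualRestrictScalarsIso f M).symm _,
    fun _ => hasInjectiveDimensionLT_of_iso (rightDualRestrictScalarsIso f M) _⟩

include F in
-- A bound for `R` applies to restrictions of `S`-modules. Conversely, a right `R`-module is a
-- retract of the restriction of its coextension, and the functor `RightDual` preserves retracts.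
theorem weakGlobalDim_le_iff (n : ℕ) :
    weakGlobalDim.{max u v, w} S ≤ n ↔ weakGlobalDim.{u, max v w} R ≤ n := by
  rw [_root_.weakGlobalDim_le_iff, _root_.weakGlobalDim_le_iff]
  constructor
  · intro h N
    let N' : ModuleCat.{max u v w} Rᵐᵒᵖ := N
    let M : ModuleCat.{max u v w} Sᵐᵒᵖ := (ModuleCat.coextendScalars (RingHom.op f)).obj N'
    let ρ := BimoduleRetraction.retract.{u, v, w} F.toBimoduleRetraction.op N'
    have := (F.hasInjectiveDimensionLE_rightDual_iff n M).2 (h M)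
    have ρ' : Retract (ModuleCat.of R (RightDual R N'))
        (ModuleCat.of R (RightDual R ((ModuleCat.restrictScalars (RingHom.op f)).obj M))) :=
      { i := ModuleCat.ofHom (RightDual.map (R := R) ρ.r.hom)
        r := ModuleCat.ofHom (RightDual.map (R := R) ρ.i.hom)
        retract := by
          ext χ
          refine RightDual.ext (R := R) (M := N') fun m => ?_
          exact congrArg χ (congrArg (fun k => k.hom m) ρ.retract) }
    exact ρ'.hasInjectiveDimensionLT (n + 1)
  · exact fun h M => (F.hasInjectiveDimensionLE_rightDual_iff n M).1 (h _)

include F in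
theorem weakGlobalDim_eq : weakGlobalDim.{max u v, w} S = weakGlobalDim.{u, max v w} R := by
  refine le_antisymm ?_ ?_
  · induction h : weakGlobalDim.{u, max v w} R using ENat.recTopCoe with
    | top => exact le_top
    | coe n => exact (F.weakGlobalDim_le_iff n).2 h.le
  · induction h : weakGlobalDim.{max u v, w} S using ENat.recTopCoe with
    | top => exact le_top
    | coe n => exact (F.weakGlobalDim_le_iff n).1 h.le

end SplitFrobeniusSystem

end FrobeniusExtension

/-! ### The crossed product as a Frobenius extension of its coefficient ring -/

namespace UnitalTwistedPartialAction

variable {G R : Type*} [Group G] [Ring R] (α : UnitalTwistedPartialAction G R)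

theorem actExt_map_one (g : G) : α.actExt g 1 = α.idem g := by
  rw [← α.idem_one, α.actExt_idem, mul_one, α.idem_idem]

/-- The cocycle identity at `(g, g⁻¹, g)`. It makes the left relative inverse of `1_g δ_g` a right
one as well. -/
theorem actExt_w_inv (g : G) : α.actExt g (α.w g⁻¹ g) = α.w g g⁻¹ := by
  have h := α.actExt_w g g⁻¹ g
  rw [inv_mul_cancel, mul_inv_cancel, α.w_one_right, α.w_one_left,
    α.mul_idem (α.actExt_mem _ _), α.mul_idem (α.w_mem_left _ _)] at h
  exact h

/-- The extension of `α_g⁻¹` to all of `R` by `x ↦ α_g⁻¹ (1_g x)`. -/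
def invActExt (g : G) (x : R) : R := (α.act g).symm ⟨α.idem g * x, α.idem_mul_mem _ _⟩

theorem idem_mul_invActExt (g : G) (x : R) :
    α.idem g⁻¹ * α.invActExt g x = α.invActExt g x :=
  α.idem_mul ((α.act g).symm _).2

theorem actExt_invActExt (g : G) (x : R) : α.actExt g (α.invActExt g x) = α.idem g * x := by
  unfold invActExt
  rw [α.actExt_apply ((α.act g).symm _).2]
  simp

namespace CrossedProduct

theorem δ_mul_δ (g h : G) (a : α.D g) (b : α.D h) :
    δ α g a * δ α h b = δ α (g * h) (α.mulCoeff g h a b) := mulHom_δ α g h a b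

/-- The element `(1_g x) δ_g`, for `x` in `R`. -/
noncomputable def monomial (g : G) (x : R) : α.CrossedProduct :=
  δ α g ⟨α.idem g * x, α.idem_mul_mem _ _⟩

theorem monomial_congr {g h : G} (e : g = h) {x y : R} (hxy : α.idem h * x = α.idem h * y) :
    monomial α g x = monomial α h y := by
  subst e
  exact δ_congr α rfl hxy

theorem monomial_idem_mul (g : G) (x : R) : monomial α g (α.idem g * x) = monomial α g x :=
  monomial_congr α rfl (by rw [← mul_assoc, α.idem_idem])

theorem monomial_coe (g : G) (a : α.D g) : monomial α g a = δ α g a :=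
  δ_congr α rfl (α.idem_mul a.2)

theorem monomial_mul (g h : G) (x y : R) :
    monomial α g x * monomial α h y = monomial α (g * h) (x * α.actExt g y * α.w g h) := by
  unfold monomial
  rw [δ_mul_δ]
  refine δ_congr α rfl ?_
  rw [coe_mulCoeff, α.actExt_mul, α.actExt_idem]
  have e (z : R) : α.idem g * (z * α.w g h) = z * α.w g h :=
    α.idem_mul ((α.D g).mul_mem_left _ _ (α.w_mem_left g h))
  have e' (z : R) : α.idem (g * h) * (z * α.w g h) = z * α.w g h :=
    α.idem_mul ((α.D (g * h)).mul_mem_left _ _ (α.w_mem_right g h))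
  have e1 := e (x * α.actExt g y)
  have e2 := e' (x * α.actExt g y)
  simp only [mul_assoc] at e1 e2 ⊢
  rw [e', e, e1, e2]

/-- The inclusion `r ↦ r δ_1` of the coefficient ring. -/
noncomputable def coeff : R →+* α.CrossedProduct where
  toFun r := monomial α 1 r
  map_one' := δ_congr α rfl (by
    change α.idem 1 * 1 = 1
    rw [α.idem_one, one_mul])
  map_mul' r s := by
    rw [monomial_mul, α.actExt_one, α.w_one_left]
    refine monomial_congr α (mul_one 1).symm ?_
    rw [α.idem_one, mul_one, mul_one]
  map_zero' := by
    unfold monomial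
    rw [← map_zero (δ α 1)]
    exact δ_congr α rfl (mul_zero _)
  map_add' r s := by
    unfold monomial
    rw [← map_add]
    exact δ_congr α rfl (mul_add _ _ _)

theorem coeff_apply (r : R) : coeff α r = monomial α 1 r := rfl

theorem coeff_mul_monomial (r : R) (g : G) (x : R) :
    coeff α r * monomial α g x = monomial α g (r * x) := by
  rw [coeff_apply, monomial_mul, α.actExt_one, α.w_one_left]
  refine monomial_congr α (one_mul g) ?_
  rw [← α.idem_comm, ← mul_assoc, α.idem_idem]

theorem monomial_mul_coeff (g : G) (x r : R) :
    monomial α g x * coeff α r = monomial α g (x * α.actExt g r) := by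
  rw [coeff_apply, monomial_mul, α.w_one_right]
  refine monomial_congr α (mul_one g) ?_
  rw [← α.idem_comm, ← mul_assoc, α.idem_idem]

/-- An inverse of `1_g δ_g` relative to the idempotents `1_{g⁻¹}` and `1_g`. -/
noncomputable def invMonomial (g : G) : α.CrossedProduct := monomial α g⁻¹ (α.winv g⁻¹ g)

theorem invMonomial_mul_coeff_idem (g : G) :
    invMonomial α g * coeff α (α.idem g) = invMonomial α g := by
  unfold invMonomial
  rw [monomial_mul_coeff, α.actExt_idem, inv_mul_cancel, α.idem_one, mul_one, ← α.idem_comm,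
    monomial_idem_mul]

theorem invMonomial_mul_monomial (g : G) :
    invMonomial α g * monomial α g 1 = coeff α (α.idem g⁻¹) := by
  unfold invMonomial
  rw [monomial_mul, α.actExt_map_one, ← α.idem_comm, mul_assoc, α.winv_mul_w, inv_mul_cancel,
    α.idem_one, mul_one, α.idem_idem, coeff_apply]

theorem monomial_mul_invMonomial (g : G) :
    monomial α g 1 * invMonomial α g = coeff α (α.idem g) := by
  unfold invMonomial
  rw [monomial_mul, one_mul, ← α.actExt_w_inv, ← α.actExt_mul, α.winv_mul_w, inv_mul_cancel,
    α.idem_one, mul_one, α.actExt_idem, mul_inv_cancel, α.idem_one, mul_one, coeff_apply]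

theorem monomial_mul_coeff_invActExt (g : G) (r : R) :
    monomial α g 1 * coeff α (α.invActExt g r) = monomial α g r := by
  rw [monomial_mul_coeff, one_mul, α.actExt_invActExt, monomial_idem_mul]

theorem monomial_mul_monomial_one (h g : G) (x : R) : monomial α h x * monomial α g 1 =
    monomial α (h * g) 1 * coeff α (α.invActExt (h * g) (x * α.w h g)) := by
  rw [monomial_mul_coeff_invActExt, monomial_mul, α.actExt_map_one, mul_assoc,
    α.idem_mul (α.w_mem_left h g)]

/-- The coefficient is the one of `monomial_mul_monomial_one`, and this coincidence is what makes `∑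
u_g ⊗ v_g` commute with the crossed product. It follows by inserting `1_g = u_g v_g` on the right
and cancelling `v_{hg} u_{hg}` on the left. -/
theorem invMonomial_mul_monomial_eq (h g : G) (x : R) : invMonomial α (h * g) * monomial α h x =
    coeff α (α.invActExt (h * g) (x * α.w h g)) * invMonomial α g := by
  have h1 : monomial α h x * coeff α (α.idem g) = coeff α (α.idem (h * g)) * monomial α h x := by
    rw [monomial_mul_coeff, coeff_mul_monomial, α.actExt_idem, ← mul_assoc, ← α.idem_comm h,
      mul_assoc, monomial_idem_mul, α.idem_comm]
  rw [← invMonomial_mul_coeff_idem, mul_assoc, ← h1, ← monomial_mul_invMonomial,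
    ← mul_assoc (monomial α h x), monomial_mul_monomial_one, ← mul_assoc, ← mul_assoc,
    invMonomial_mul_monomial, ← map_mul, α.idem_mul_invActExt]

theorem monomial_one_mul_coeff_mul_invMonomial (g : G) (r : R) :
    monomial α g 1 * coeff α r * invMonomial α g = coeff α (α.actExt g r) := by
  have : monomial α g 1 * coeff α r = coeff α (α.actExt g r) * monomial α g 1 := by
    rw [monomial_mul_coeff, coeff_mul_monomial, one_mul, mul_one]
  rw [this, mul_assoc, monomial_mul_invMonomial, ← map_mul, α.mul_idem (α.actExt_mem g r)]

/-- The coefficient of `δ_1`. -/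
noncomputable def coeffOne : α.CrossedProduct →+ R :=
  AddMonoidHom.comp (AddMonoidHom.mk' (fun a : α.D 1 => (a : R)) fun _ _ => rfl)
    (DFinsupp.evalAddMonoidHom (β := fun g => α.D g) 1)

theorem coeffOne_monomial_of_ne {g : G} (hg : g ≠ 1) (x : R) :
    coeffOne α (monomial α g x) = 0 := by
  classical
  exact congrArg Subtype.val (DirectSum.of_eq_of_ne (β := fun g => α.D g) g 1 _ hg.symm)

theorem coeffOne_monomial_one (x : R) : coeffOne α (monomial α 1 x) = x := by
  classical
  refine (congrArg Subtype.val (DirectSum.of_eq_same (β := fun g => α.D g) 1 _)).trans ?_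
  change α.idem 1 * x = x
  rw [α.idem_one, one_mul]

/-- The coefficient of `δ_1` is a bimodule retraction of the inclusion of the coefficients. -/
noncomputable def bimoduleRetraction : BimoduleRetraction (coeff α) where
  π := coeffOne α
  π_left r s := by
    refine induction α s (by simp) (fun g a => ?_) fun s t hs ht => by
      rw [mul_add, map_add, hs, ht, map_add, mul_add]
    rw [← monomial_coe, coeff_mul_monomial]
    by_cases hg : g = 1
    · subst hg
      rw [coeffOne_monomial_one, coeffOne_monomial_one]
    · rw [coeffOne_monomial_of_ne α hg, coeffOne_monomial_of_ne α hg, mul_zero]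
  π_right r s := by
    refine induction α s (by simp) (fun g a => ?_) fun s t hs ht => by
      rw [add_mul, map_add, hs, ht, map_add, add_mul]
    rw [← monomial_coe, monomial_mul_coeff]
    by_cases hg : g = 1
    · subst hg
      rw [coeffOne_monomial_one, coeffOne_monomial_one, α.actExt_one]
    · rw [coeffOne_monomial_of_ne α hg, coeffOne_monomial_of_ne α hg, zero_mul]
  π_one := by
    rw [← map_one (coeff α), coeff_apply, coeffOne_monomial_one]

/-- The elements `1_g δ_g` and their relative inverses form a Frobenius system, which any central
element of trace `1` makes separable. -/
noncomputable def splitFrobeniusSystem [Fintype G] (c : R) (hc : c ∈ Subring.center R)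
    (htr : ∑ g, α.actExt g c = 1) : SplitFrobeniusSystem (coeff α) G where
  toBimoduleRetraction := bimoduleRetraction α
  u g := monomial α g 1
  v g := invMonomial α g
  c := c
  c_mem_center := hc
  exists_matrix s := by
    classical
    refine induction α s ⟨0, by simp, by simp⟩ (fun h a => ?_) ?_
    · rw [← monomial_coe]
      -- Multiplication by `a δ_h` takes the index `g` to `h * g`, so each row and each column has a
      -- single possibly nonzero entry.
      refine ⟨fun k g => if k = h * g then α.invActExt k (a * α.w h g) else 0,
        fun k => ?_, fun g => ?_⟩
      · rw [Finset.sum_eq_single (h⁻¹ * k)]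
        · dsimp only
          rw [if_pos (mul_inv_cancel_left h k).symm]
          have := invMonomial_mul_monomial_eq α h (h⁻¹ * k) a
          rwa [mul_inv_cancel_left] at this
        · intro g _ hg
          dsimp only
          rw [if_neg (fun e : k = h * g => hg (by rw [e, inv_mul_cancel_left])), map_zero, zero_mul]
        · exact fun h => absurd (Finset.mem_univ _) h
      · rw [Finset.sum_eq_single (h * g)]
        · dsimp only
          rw [if_pos rfl, monomial_mul_monomial_one]
        · intro k _ hk
          dsimp only
          rw [if_neg hk, map_zero, mul_zero]
        · exact fun h => absurd (Finset.mem_univ _) h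
    · rintro s t ⟨a, h1, h2⟩ ⟨b, h3, h4⟩
      refine ⟨a + b, fun i => ?_, fun j => ?_⟩
      · simp only [mul_add, h1, h3, Pi.add_apply, map_add, add_mul, Finset.sum_add_distrib]
      · simp only [add_mul, h2, h4, Pi.add_apply, map_add, mul_add, Finset.sum_add_distrib]
  sum_u_π_v := by
    -- The element `v_g` is supported at `g⁻¹`, so `π` sees only `g = 1`.
    rw [Finset.sum_eq_single 1]
    · have h1 : coeff α (coeffOne α (invMonomial α 1)) = invMonomial α 1 := by
        have : invMonomial α 1 = coeff α (α.winv 1⁻¹ 1) := monomial_congr α inv_one rfl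
        rw [this]
        exact congrArg (coeff α) (coeffOne_monomial_one α _)
      change monomial α 1 1 * coeff α (coeffOne α (invMonomial α 1)) = 1
      rw [h1, monomial_mul_invMonomial, α.idem_one, map_one]
    · intro g _ hg
      change monomial α g 1 * coeff α (coeffOne α (invMonomial α g)) = 0
      rw [invMonomial, coeffOne_monomial_of_ne α (inv_ne_one.2 hg), map_zero, mul_zero]
    · exact fun h => absurd (Finset.mem_univ _) h
  sum_u_c_v := by
    -- Since `u_g c v_g = α_g(1_{g⁻¹} c)`, the sum is the trace of `c`.
    simp only [monomial_one_mul_coeff_mul_invMonomial]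
    rw [← map_sum, htr, map_one]

end CrossedProduct

end UnitalTwistedPartialAction

/-! ### Weighted orbit counting -/

/-- The elements taking `x` to `y` form a left coset of the stabilizer of `x`. -/
theorem card_filter_smul_eq {G X : Type*} [Group G] [Fintype G] [MulAction G X] [DecidableEq X]
    {x y : X} (h : y ∈ MulAction.orbit G x) :
    (Finset.univ.filter fun g : G => g • x = y).card = Nat.card (MulAction.stabilizer G x) := by
  classical
  obtain ⟨g₀, rfl⟩ := h
  rw [Nat.card_eq_fintype_card, Fintype.card_subtype]
  refine Finset.card_bij (fun g _ => g₀⁻¹ * g) ?_ (fun _ _ _ _ => mul_left_cancel) fun g hg => ?_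
  · intro g hg
    rw [Finset.mem_filter] at hg ⊢
    refine ⟨Finset.mem_univ _, ?_⟩
    rw [MulAction.mem_stabilizer_iff, mul_smul, hg.2]
    exact inv_smul_smul _ _
  · rw [Finset.mem_filter, MulAction.mem_stabilizer_iff] at hg
    refine ⟨g₀ * g, ?_, inv_mul_cancel_left _ _⟩
    rw [Finset.mem_filter, mul_smul, hg.2]
    exact ⟨Finset.mem_univ _, rfl⟩

/-- Weighted sums over the translates of orbit representatives exhaust the whole set. -/
theorem sum_sum_card_div_card_stabilizer_nsmul {G X A : Type*} [Group G] [Fintype G] [MulAction G X]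
    [Fintype X] [AddCommMonoid A] (f : X → A) (Q : Type*) [Fintype Q] (cl : X → Q) (r : Q → X)
    (hr : ∀ x q, cl x = q ↔ x ∈ MulAction.orbit G (r q)) :
    ∑ g : G, ∑ q, (Nat.card G / Nat.card (MulAction.stabilizer G (r q))) • f (g • r q) =
      Nat.card G • ∑ x, f x := by
  classical
  have h1 : ∀ q, ∑ g : G, f (g • r q) =
      ∑ x, if cl x = q then Nat.card (MulAction.stabilizer G (r q)) • f x else 0 := by
    intro q
    rw [← Finset.sum_fiberwise (s := Finset.univ) (g := fun g : G => g • r q)]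
    refine Finset.sum_congr rfl fun x _ => ?_
    rw [Finset.sum_congr rfl (g := fun _ => f x)
      (fun g hg => by rw [(Finset.mem_filter.1 hg).2]), Finset.sum_const]
    split_ifs with h
    · rw [card_filter_smul_eq ((hr x q).1 h)]
    · rw [Finset.filter_eq_empty_iff.2, Finset.card_empty, zero_nsmul]
      intro g _ hg
      exact h ((hr x q).2 ⟨g, hg⟩)
  rw [Finset.sum_comm]
  simp only [← Finset.smul_sum, h1]
  simp only [Finset.smul_sum]
  rw [Finset.sum_comm]
  refine Finset.sum_congr rfl fun x _ => ?_
  rw [Finset.sum_eq_single (cl x)]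
  -- Each `x` is hit `|Stab|` times with weight `|G| / |Stab|`; the division is exact by Lagrange's
  -- theorem.
  · rw [if_pos rfl, ← mul_nsmul', Nat.div_mul_cancel (Subgroup.card_subgroup_dvd_card _)]
  · intro q _ hq
    rw [if_neg hq.symm, smul_zero]
  · exact fun h => absurd (Finset.mem_univ _) h

/-! ### A central element of trace one -/

namespace UnitalTwistedPartialAction

variable {G R : Type*} [Group G] [Ring R] (α : UnitalTwistedPartialAction G R)

open scoped Pointwise

/-- The idempotent `1_g`, or its complement, in the center. -/
def centralIdem (p : Prop) [Decidable p] (g : G) : Subring.center R :=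
  if p then ⟨α.idem g, α.idem_mem_center g⟩ else 1 - ⟨α.idem g, α.idem_mem_center g⟩

theorem actExt_centralIdem (p : Prop) [Decidable p] (g h : G) :
    α.actExt g (α.centralIdem p h) = α.idem g * α.centralIdem p (g * h) := by
  unfold centralIdem
  split_ifs
  · exact α.actExt_idem g h
  · change α.actExt g (1 - α.idem h) = α.idem g * (1 - α.idem (g * h))
    rw [map_sub, α.actExt_map_one, α.actExt_idem, mul_sub, mul_one]

theorem actExt_prod {ι : Type*} (g : G) (s : Finset ι) (x y : ι → Subring.center R)
    (h : ∀ i, α.actExt g (x i) = α.idem g * y i) :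
    α.actExt g (∏ i ∈ s, x i : Subring.center R) =
      α.idem g * (∏ i ∈ s, y i : Subring.center R) := by
  classical
  induction s using Finset.induction_on with
  | empty => simpa using α.actExt_map_one g
  | insert i s hi ih =>
    rw [Finset.prod_insert hi, Finset.prod_insert hi, Subring.coe_mul, Subring.coe_mul,
      α.actExt_mul, h, ih, α.idem_comm g (y i), mul_assoc, ← mul_assoc (α.idem g) (α.idem g),
      α.idem_idem, ← mul_assoc, ← α.idem_comm, mul_assoc]

variable [Fintype G] [DecidableEq G]

/-- The idempotent `∏_{g ∈ A} 1_g ∏_{g ∉ A} (1 - 1_g)` of the center. -/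
def atom (A : Finset G) : Subring.center R := ∏ g, α.centralIdem (g ∈ A) g

/-- Expand the product of the factors `1_g + (1 - 1_g) = 1`. -/
theorem sum_atom : ∑ A, α.atom A = 1 := by
  have h := Finset.prod_add (fun g => (⟨α.idem g, α.idem_mem_center g⟩ : Subring.center R))
    (fun g => 1 - ⟨α.idem g, α.idem_mem_center g⟩) Finset.univ
  simp only [add_sub_cancel, Finset.prod_const_one, Finset.powerset_univ] at h
  rw [h]
  refine Finset.sum_congr rfl fun A _ => ?_
  unfold atom centralIdem
  rw [Finset.prod_ite, Finset.filter_mem_eq_inter, Finset.univ_inter, Finset.filter_not,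
    Finset.filter_mem_eq_inter, Finset.univ_inter]

/-- Since `1_e = 1`, the factor at the identity is `1 - 1 = 0`. -/
theorem atom_eq_zero {A : Finset G} (h : 1 ∉ A) : α.atom A = 0 := by
  refine Finset.prod_eq_zero (Finset.mem_univ 1) ?_
  unfold centralIdem
  rw [if_neg h]
  exact Subtype.ext (by simp [α.idem_one])

theorem idem_mul_atom {A : Finset G} {g : G} (h : g ∈ A) :
    α.idem g * (α.atom A : R) = α.atom A := by
  unfold atom
  rw [← Finset.mul_prod_erase _ _ (Finset.mem_univ g), Subring.coe_mul, ← mul_assoc]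
  congr 1
  unfold centralIdem
  rw [if_pos h]
  exact α.idem_idem g

/-- Left translation by `g` permutes the factors up to a factor `1_g`. The hypothesis `1 ∈ A` gives
`g ∈ g • A`, so the atom of `g • A` absorbs it. -/
theorem actExt_atom (g : G) {A : Finset G} (h : 1 ∈ A) :
    α.actExt g (α.atom A) = α.atom (g • A) := by
  have h1 : g ∈ g • A := by simpa using Finset.smul_mem_smul_finset (a := g) h
  rw [← α.idem_mul_atom h1]
  unfold atom
  rw [α.actExt_prod g _ _ _ fun i => α.actExt_centralIdem _ g i]
  congr 2
  refine Fintype.prod_equiv (Equiv.mulLeft g) _ _ fun i => ?_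
  have h2 : (i ∈ A) = (Equiv.mulLeft g i ∈ g • A) :=
    propext (Finset.smul_mem_smul_finset_iff g).symm
  simp only [h2]
  rfl

omit [DecidableEq G] in
-- The orbits are those of `G` acting by left translation on its subsets; the weighted sum of the
-- atoms of their representatives has trace `|G| ∑ e_A = |G|`.
theorem exists_mem_center_sum_actExt_eq_one (hG : IsUnit (Nat.card G : R)) :
    ∃ c ∈ Subring.center R, ∑ g, α.actExt g c = 1 := by
  classical
  let Q := MulAction.orbitRel.Quotient G (Finset G)
  -- A representative contains `1` whenever some member of its orbit does, so that `actExt_atom`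
  -- applies to it.
  have hQ : ∀ q : Q, ∃ A : Finset G, (Quotient.mk'' A : Q) = q ∧
      ∀ B : Finset G, (Quotient.mk'' B : Q) = q → 1 ∈ B → 1 ∈ A := by
    intro q
    by_cases h : ∃ B : Finset G, (Quotient.mk'' B : Q) = q ∧ 1 ∈ B
    · obtain ⟨B, hB, h1⟩ := h
      exact ⟨B, hB, fun _ _ _ => h1⟩
    · obtain ⟨A, hA⟩ := Quotient.exists_rep q
      exact ⟨A, hA, fun B hB h1 => absurd ⟨B, hB, h1⟩ h⟩
  choose r hr hr1 using hQ
  have hcl : ∀ (A : Finset G) (q : Q), (Quotient.mk'' A : Q) = q ↔ A ∈ MulAction.orbit G (r q) := by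
    intro A q
    rw [← MulAction.orbitRel_apply]
    conv_lhs => rw [← hr q]
    exact Quotient.eq''
  have hact : ∀ (g : G) (q : Q), α.actExt g (α.atom (r q)) = α.atom (g • r q) := by
    intro g q
    by_cases h : 1 ∈ r q
    · exact α.actExt_atom g h
    -- Here no member of the orbit contains `1`, so both atoms vanish.
    · rw [α.atom_eq_zero h, α.atom_eq_zero fun h' => h (hr1 q _ ((hcl _ _).2 ⟨g, rfl⟩) h')]
      exact map_zero _
  have hsum := sum_sum_card_div_card_stabilizer_nsmul (G := G)
    (fun A => (α.atom A : R)) Q (fun A => Quotient.mk'' A) r hcl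
  set c' : Subring.center R :=
    ∑ q, (Nat.card G / Nat.card (MulAction.stabilizer G (r q))) • α.atom (r q) with hc'
  have hc'sum : ∑ g, α.actExt g (c' : R) = Nat.card G := by
    have h1 : ∑ A, (α.atom A : R) = 1 := by
      rw [← AddSubmonoidClass.coe_finsetSum, α.sum_atom]; rfl
    rw [h1, nsmul_one] at hsum
    rw [← hsum]
    refine Finset.sum_congr rfl fun g _ => ?_
    rw [hc', AddSubmonoidClass.coe_finsetSum, map_sum]
    refine Finset.sum_congr rfl fun q _ => ?_
    rw [← hact, ← map_nsmul]
    rfl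
  obtain ⟨z, hz⟩ := hG
  have hzc : ((z⁻¹ : Rˣ) : R) ∈ Subring.center R := by
    rw [Subring.mem_center_iff]
    intro x
    have : Commute x (z : R) := by rw [hz]; exact Nat.commute_cast x _
    exact this.units_inv_right
  refine ⟨(z⁻¹ : Rˣ) * c', mul_mem hzc c'.2, ?_⟩
  -- Multiplication by the integer `|G|` passes through the additive map `actExt g` and cancels
  -- `z⁻¹` inside it, so `z⁻¹` need not be pulled out.
  have h2 : (Nat.card G : R) * ∑ g, α.actExt g ((z⁻¹ : Rˣ) * (c' : R)) = Nat.card G := by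
    rw [← nsmul_eq_mul, Finset.smul_sum]
    refine Eq.trans (Finset.sum_congr rfl fun g _ => ?_) hc'sum
    rw [← map_nsmul, nsmul_eq_mul, ← hz, Units.mul_inv_cancel_left]
  rw [← hz] at h2
  rw [← Units.mul_right_inj z, h2, mul_one]

end UnitalTwistedPartialAction

/-- The universe levels place the modules over both rings in `Type (max u v w)`. -/
theorem mainTheorem10 {R : Type u} {G : Type v} [Ring R] [Group G] [Finite G]
    (α : UnitalTwistedPartialAction G R) (hG : IsUnit (Nat.card G : R)) :
    weakGlobalDim.{max u v, w} α.CrossedProduct = weakGlobalDim.{u, max v w} R := by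
  have := Fintype.ofFinite G
  obtain ⟨c, hc, htr⟩ := α.exists_mem_center_sum_actExt_eq_one hG
  exact (UnitalTwistedPartialAction.CrossedProduct.splitFrobeniusSystem α c hc htr).weakGlobalDim_eq
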